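/- Let $0<q<1$, let $\tau$ be a positive integer and $t=q^{\tau}$; let $\alpha\in\mathbb C$, $a_1,b_1\in\mathbb C^*$. Write $(a)_\infty=\prod_{i\ge 0}(1-q^i a)$ and $\theta(a)=(a)_\infty(q/a)_\infty$; complex powers $z^{\alpha}$ are principal. For $z=(z_1,\dots,z_n)\in(\mathbb C^*)^n$ put $$\Phi(z)=\prod_{i=1}^n z_i^{\alpha}\frac{(qa_1^{-1}z_i)_\infty}{(b_1z_i)_\infty}\prod_{1\le i<j\le n}z_i^{2\tau-1}\frac{(qt^{-1}z_j/z_i)_\infty}{(tz_j/z_i)_\infty},\qquad \Delta(z)=\prod_{1\le i<j\le n}(z_i-z_j),$$ where $(qt^{-1}u)_\infty/(tu)_\infty$ is understood as a meromorphic function of $u$ with its removable singularities filled in (since $\tau$ is a positive integer it is the polynomial $\prod_{l=1-\tau}^{\tau-1}(1-q^lu)$). The bilateral Jackson integral of A-type is $$I(x_1,\dots,x_n)=(1-q)^n\sum_{\nu\in\mathbb Z^n}\Phi(x_1q^{\nu_1},\dots,x_nq^{\nu_n})\,\Delta(x_1q^{\nu_1},\dots,x_nq^{\nu_n}).$$ Assume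 $|qa_1^{-1}b_1^{-1}|<|q^{\alpha}t^{2i-2}|<1$ for $i=1,\dots,n$. Then for every $x\in\mathbb C^*$ such that $b_1x\notin\{q^k: k\in\mathbb Z\}$ (that is, no point of the lattice of summation is a pole of $\Phi$), the series defining $I(x,x,\dots,x)$ converges absolutely and $$\frac{I(x,x,\dots,x)}{n!}=c_1\prod_{i=1}^n (xt^{i-1})^{\alpha+2(n-i)\tau}\,\frac{\theta(q^{\alpha}b_1t^{n+i-2}x)}{\theta(b_1t^{i-1}x)},$$ where $$c_1=(1-q)^n\prod_{j=1}^n\frac{(q)_\infty\,(t)_\infty\,(qa_1^{-1}b_1^{-1}t^{-(j-1)})_\infty}{(t^j)_\infty\,(q^{\alpha}t^{j-1})_\infty\,(q^{1-\alpha}a_1^{-1}b_1^{-1}t^{-(n+j-2)})_\infty}.$$ -/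

import Mathlib

open Filter Topology

namespace QSelberg

noncomputable section

/-- The infinite `q`-shifted factorial `(a)_∞ = ∏_{i ≥ 0} (1 - q^i a)`. -/
def qPoch (q : ℝ) (a : ℂ) : ℂ := ∏' i : ℕ, (1 - (q : ℂ) ^ i * a)

/-- The theta function `θ(a) = (a)_∞ (q/a)_∞`. -/
def qTheta (q : ℝ) (a : ℂ) : ℂ := qPoch q a * qPoch q ((q : ℂ) / a)

/-- The value at `u` of the meromorphic function `u ↦ (q t⁻¹ u)_∞ / (t u)_∞`. The value is taken
as the limit along the punctured neighbourhood of `u`, so that removable singularities (common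
zeros of numerator and denominator) are filled in; when `t = q^τ` with `τ` a positive integer this
is a polynomial in `u`, see `pairQuot_eq_prod`. -/
def pairQuot (q : ℝ) (t u : ℂ) : ℂ :=
  limUnder (𝓝[≠] u) fun w : ℂ => qPoch q ((q : ℂ) * t⁻¹ * w) / qPoch q (t * w)

theorem qPoch_multipliable (q : ℝ) (hq0 : 0 < q) (hq1 : q < 1) (a : ℂ) :
    Multipliable fun i : ℕ => (1 - (q : ℂ) ^ i * a) := by
  have : Summable fun i : ℕ => ‖-((q : ℂ) ^ i * a)‖ := by
    simp only [norm_neg, norm_mul, norm_pow, Complex.norm_real, Real.norm_of_nonneg hq0.le]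
    exact (summable_geometric_of_lt_one hq0.le hq1).mul_right _
  simpa [sub_eq_add_neg] using multipliable_one_add_of_summable this

theorem qPoch_ne_zero (q : ℝ) (hq0 : 0 < q) (hq1 : q < 1) (a : ℂ)
    (ha : ∀ i : ℕ, (q : ℂ) ^ i * a ≠ 1) : qPoch q a ≠ 0 := by
  have : Summable fun i : ℕ => ‖-((q : ℂ) ^ i * a)‖ := by
    simp only [norm_neg, norm_mul, norm_pow, Complex.norm_real, Real.norm_of_nonneg hq0.le]
    exact (summable_geometric_of_lt_one hq0.le hq1).mul_right _
  have h := tprod_one_add_ne_zero_of_summable (f := fun i : ℕ => -((q : ℂ) ^ i * a))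
    (fun i h => ha i (by linear_combination -h)) this
  simpa [qPoch, sub_eq_add_neg] using h

theorem qPoch_eq_prod_mul (q : ℝ) (hq0 : 0 < q) (hq1 : q < 1) (a : ℂ) (m : ℕ) :
    qPoch q a = (∏ l ∈ Finset.range m, (1 - (q : ℂ) ^ l * a)) * qPoch q ((q : ℂ) ^ m * a) := by
  have h := qPoch_multipliable q hq0 hq1 ((q : ℂ) ^ m * a)
  have h2 : Multipliable fun i : ℕ => (1 - (q : ℂ) ^ (i + m) * a) := by
    simpa [pow_add, mul_assoc] using h
  rw [qPoch, ← Multipliable.prod_mul_tprod_nat_mul' (f := fun i : ℕ => (1 - (q : ℂ) ^ i * a)) h2]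
  simp [qPoch, pow_add, mul_assoc]

/-- For `t = q^τ` with `τ` a positive integer, `(q t⁻¹ u)_∞ / (t u)_∞` is the polynomial
`∏_{1-τ ≤ l ≤ τ-1} (1 - q^l u)`. -/
theorem pairQuot_eq_prod (q : ℝ) (hq0 : 0 < q) (hq1 : q < 1) (τ : ℕ) (hτ : 0 < τ) (u : ℂ) :
    pairQuot q ((q : ℂ) ^ (τ : ℂ)) u =
      ∏ l ∈ Finset.Icc (1 - (τ : ℤ)) (τ - 1), (1 - (q : ℂ) ^ l * u) := by
  have hqc : (q : ℂ) ≠ 0 := by exact_mod_cast hq0.ne'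
  have hprod : ∀ w : ℂ, ∏ l ∈ Finset.Icc (1 - (τ : ℤ)) (τ - 1), (1 - (q : ℂ) ^ l * w) =
      ∏ l ∈ Finset.range (2 * τ - 1), (1 - (q : ℂ) ^ l * ((q : ℂ) * ((q : ℂ) ^ τ)⁻¹ * w)) := by
    intro w
    symm
    refine Finset.prod_nbij (fun l : ℕ => (l : ℤ) + 1 - τ) ?_ ?_ ?_ ?_
    · intro l hl
      simp only [Finset.mem_range] at hl
      simp only [Finset.mem_Icc]
      omega
    · intro a _ b _ h
      simp only at h
      omega
    · intro l hl
      simp only [Finset.coe_Icc, Set.mem_Icc] at hl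
      refine ⟨(l + τ - 1).toNat, ?_, ?_⟩
      · simp only [Finset.coe_range, Set.mem_Iio]
        omega
      · simp only
        omega
    · intro l _
      rw [zpow_sub₀ hqc, zpow_add₀ hqc]
      simp only [zpow_natCast, zpow_one]
      ring
  have hev : ∀ᶠ w in 𝓝[≠] u, ∀ i : ℕ, (q : ℂ) ^ i * ((q : ℂ) ^ τ * w) ≠ 1 := by
    have hlim : Tendsto (fun i : ℕ => q ^ i * (q ^ τ * (‖u‖ + 1))) atTop (𝓝 0) := by
      simpa using (tendsto_pow_atTop_nhds_zero_of_lt_one hq0.le hq1).mul_const (q ^ τ * (‖u‖ + 1))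
    obtain ⟨N, hN⟩ := (hlim.eventually (gt_mem_nhds one_pos)).exists_forall_of_atTop
    have hball : ∀ᶠ w in 𝓝[≠] u, ‖w‖ < ‖u‖ + 1 :=
      ((continuous_norm.tendsto u).eventually (gt_mem_nhds (lt_add_one _))).filter_mono
        nhdsWithin_le_nhds
    have hfin : ∀ᶠ w in 𝓝[≠] u, ∀ i ∈ Finset.range N, (q : ℂ) ^ i * ((q : ℂ) ^ τ * w) ≠ 1 := by
      rw [Filter.eventually_all_finset]
      intro i _
      by_cases h : u = ((q : ℂ) ^ i * (q : ℂ) ^ τ)⁻¹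
      · filter_upwards [self_mem_nhdsWithin] with w hw heq
        apply hw
        rw [Set.mem_singleton_iff, h]
        exact eq_inv_of_mul_eq_one_right (by rw [mul_assoc]; exact heq)
      · have h1 : ∀ᶠ w in 𝓝 u, w ≠ ((q : ℂ) ^ i * (q : ℂ) ^ τ)⁻¹ := isOpen_ne.mem_nhds h
        filter_upwards [h1.filter_mono nhdsWithin_le_nhds] with w hw heq
        exact hw (eq_inv_of_mul_eq_one_right (by rw [mul_assoc]; exact heq))
    filter_upwards [hball, hfin] with w hw1 hw2 i
    rcases lt_or_ge i N with hi | hi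
    · exact hw2 i (Finset.mem_range.2 hi)
    · intro heq
      have h1 := congrArg norm heq
      simp only [norm_mul, norm_pow, Complex.norm_real, Real.norm_of_nonneg hq0.le, norm_one] at h1
      have h2 := hN i hi
      have h3 : q ^ i * (q ^ τ * ‖w‖) ≤ q ^ i * (q ^ τ * (‖u‖ + 1)) := by gcongr
      linarith
  rw [pairQuot, Complex.cpow_natCast, hprod u]
  refine Tendsto.limUnder_eq ?_
  have hcont : Continuous fun w : ℂ =>
      ∏ l ∈ Finset.range (2 * τ - 1), (1 - (q : ℂ) ^ l * ((q : ℂ) * ((q : ℂ) ^ τ)⁻¹ * w)) := by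
    fun_prop
  refine ((hcont.tendsto u).mono_left nhdsWithin_le_nhds).congr' ?_
  filter_upwards [hev] with w hw
  have hne := qPoch_ne_zero q hq0 hq1 _ hw
  rw [qPoch_eq_prod_mul q hq0 hq1 ((q : ℂ) * ((q : ℂ) ^ τ)⁻¹ * w) (2 * τ - 1)]
  have : (q : ℂ) ^ (2 * τ - 1) * ((q : ℂ) * ((q : ℂ) ^ τ)⁻¹ * w) = (q : ℂ) ^ τ * w := by
    have h4 : (q : ℂ) ^ (2 * τ - 1) * q = (q : ℂ) ^ τ * (q : ℂ) ^ τ := by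
      rw [← pow_succ, ← pow_add]
      congr 1
      omega
    have h5 : (q : ℂ) ^ τ ≠ 0 := pow_ne_zero _ hqc
    calc _ = ((q : ℂ) ^ (2 * τ - 1) * q) * ((q : ℂ) ^ τ)⁻¹ * w := by ring
      _ = _ := by rw [h4]; field_simp
  rw [this, mul_div_assoc, div_self hne, mul_one]

/-- The function `Φ(z)`, where `t = q^τ`. Complex powers are principal. -/
def Phi (q : ℝ) (α τ a₁ b₁ : ℂ) {n : ℕ} (z : Fin n → ℂ) : ℂ :=
  (∏ i, z i ^ α * (qPoch q ((q : ℂ) * a₁⁻¹ * z i) / qPoch q (b₁ * z i))) *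
    ∏ i, ∏ j ∈ Finset.Ioi i,
      z i ^ (2 * τ - 1) * pairQuot q ((q : ℂ) ^ τ) (z j / z i)

/-- The difference product `Δ(z) = ∏_{i<j} (z_i - z_j)`. -/
def Delta {n : ℕ} (z : Fin n → ℂ) : ℂ := ∏ i, ∏ j ∈ Finset.Ioi i, (z i - z j)

/-- The point `(x_1 q^{ν_1}, …, x_n q^{ν_n})` of the `q`-lattice through `x`. -/
def latticePoint (q : ℝ) {n : ℕ} (x : Fin n → ℂ) (ν : Fin n → ℤ) : Fin n → ℂ :=
  fun i => x i * (q : ℂ) ^ ν i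

/-- The multiple bilateral Jackson integral over `[0, x∞]` of `f` with respect to
`d_q z_1 / z_1 ∧ ⋯ ∧ d_q z_n / z_n`. -/
def jacksonIntegral (q : ℝ) {n : ℕ} (x : Fin n → ℂ) (f : (Fin n → ℂ) → ℂ) : ℂ :=
  (1 - (q : ℂ)) ^ n * ∑' ν : Fin n → ℤ, f (latticePoint q x ν)

/-- The Jackson integral of A-type, `I(x) = ∫_0^{x∞} Φ(z) Δ(z) ϖ_q`. -/
def IA (q : ℝ) (α τ a₁ b₁ : ℂ) {n : ℕ} (x : Fin n → ℂ) : ℂ :=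
  jacksonIntegral q x fun z => Phi q α τ a₁ b₁ z * Delta z

end

end QSelberg

/-!
Expand the integrand at the lattice point `z = x q^ν`. Up to the one-variable weights
`z_i^α (q z_i / a₁)_∞ / (b₁ z_i)_∞`, it is the polynomial
`P(z) = ∏_{i<j} (z_i - z_j) ∏_{|l|<τ} (z_i - q^l z_j)` (`pairPoly`), which is symmetric and
homogeneous of degree `D = τ n (n - 1)`. Hence the integral is obtained by applying, in each
variable, the functional that sends `z^k` to the bilateral series `∑_ν (x q^ν)^(α+k) (⋯)`; absolute
convergence is that of these one-variable series for `0 ≤ k ≤ K = 2 (n - 1) τ`.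

The series for `k = 0` is Ramanujan's `₁ψ₁` sum (`psi_eq`). A shift of the summation index shows
that the series for `k` is the one for `0` times `a₁^k (A)_k / (r A)_k`, where `A = q^α`,
`r = a₁ b₁` and `(a)_k = ∏_{l<k} (1 - q^l a)` (`psi_pow_mul`). It remains to evaluate the image of
`P` under the `n`-fold tensor power of the functional with moments
`(A)_k (q^k r A)_{K-k}` (`mom`). This image is a polynomial in `r` (`selbergPoly`) of degree at
most `D`, and it is found from its zeros:

* The functional is carried by the points `q^ν`, `0 ≤ ν ≤ K`, with masses divisible by `(r)_ν`
  (`exists_mom_eq_sum`). As `P` vanishes unless the points `q^{ν_i}` have exponents pairwise at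
  distance at least `τ`, every term is divisible by `∏_j (r)_{jτ}` (`gapFactor_dvd`).
* In a monomial of `P` any `s` variables have total degree at least `τ s (s - 1)`, so its sorted
  exponents satisfy `λ_j ≤ (n + j - 1) τ`. Hence every term is divisible by
  `∏_j ∏_{(n+j-1)τ ≤ l < K} (1 - q^l A r)` (`majorFactor_dvd`).

For generic `A` the two products are coprime, and together they have degree `D`, so the image of
`P` is a constant multiple of their product. The constant is read off at `r = q^{-(n-1)τ}`, where
only the permutations of the single configuration `(1, t, …, t^{n-1})` contribute
(`sum_eval_pairPoly`); the masses there come from the `q`-binomial theorem. Continuity in `A`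
removes the genericity assumption (`eval_selbergPoly_eq`), and quasi-periodicity of the theta
function brings the result to the stated form (`selberg_factor_eq`).
-/

namespace QSelberg

/-! ### The one-variable moment functional -/

section Moments

open Polynomial

/-- The `k`-th moment `(A)_k (q^k r A)_{K-k}` as a polynomial in `r`, where
`(a)_k = ∏_{l<k} (1 - q^l a)`. Up to the factor `(r A)_K`, which does not depend on `k`, it is
`(A)_k / (r A)_k`; clearing the denominator in this way needs `k ≤ K`. -/
noncomputable def mom (q A : ℂ) (K k : ℕ) : ℂ[X] :=
  C (∏ l ∈ Finset.range k, (1 - q ^ l * A)) * ∏ l ∈ Finset.Ico k K, (1 - C (q ^ l * A) * X)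

/-- The linear functional on polynomials of degree at most `K` with moments `mom q A K k`;
coefficients beyond degree `K` are ignored. -/
noncomputable def momFun (q A : ℂ) (K : ℕ) (f : ℂ[X]) : ℂ[X] :=
  ∑ k ∈ Finset.range (K + 1), C (f.coeff k) * mom q A K k

/-- The monic polynomial `∏_{l<j} (z - q^l)`. -/
noncomputable def nodePoly (q : ℂ) (j : ℕ) : ℂ[X] := ∏ l ∈ Finset.range j, (X - C (q ^ l))

theorem mom_succ (q A : ℂ) (K k : ℕ) :
    mom q A (K + 1) (k + 1) = C (1 - A) * mom q (q * A) K k := by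
  unfold mom
  rw [Finset.prod_range_succ', ← Finset.prod_Ico_add' _ k K 1]
  simp only [pow_succ, pow_zero, one_mul, map_mul, map_sub, map_one, map_prod, ← mul_assoc]
  ring

/-- Multiplication by the variable amounts to replacing `A` by `q A` and `K + 1` by `K`. This
drives the induction in `momFun_nodePoly`. -/
theorem momFun_X_mul (q A : ℂ) (K : ℕ) (f : ℂ[X]) :
    momFun q A (K + 1) (X * f) = C (1 - A) * momFun q (q * A) K f := by
  unfold momFun
  rw [Finset.sum_range_succ']
  simp only [coeff_X_mul, coeff_X_mul_zero, map_zero, zero_mul, add_zero, mom_succ, Finset.mul_sum]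
  refine Finset.sum_congr rfl fun k _ => by ring

theorem momFun_sub (q A : ℂ) (K : ℕ) (f g : ℂ[X]) :
    momFun q A K (f - g) = momFun q A K f - momFun q A K g := by
  simp [momFun, sub_mul, Finset.sum_sub_distrib]

theorem momFun_add (q A : ℂ) (K : ℕ) (f g : ℂ[X]) :
    momFun q A K (f + g) = momFun q A K f + momFun q A K g := by
  simp [momFun, add_mul, Finset.sum_add_distrib]

theorem momFun_sum {ι : Type*} (q A : ℂ) (K : ℕ) (s : Finset ι) (f : ι → ℂ[X]) :
    momFun q A K (∑ i ∈ s, f i) = ∑ i ∈ s, momFun q A K (f i) := by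
  classical
  induction s using Finset.induction_on with
  | empty => simp [momFun]
  | insert a s ha ih => rw [Finset.sum_insert ha, Finset.sum_insert ha, momFun_add, ih]

theorem momFun_C_mul (q A : ℂ) (K : ℕ) (c : ℂ) (f : ℂ[X]) :
    momFun q A K (C c * f) = C c * momFun q A K f := by
  simp [momFun, Finset.mul_sum, mul_assoc]

theorem momFun_X_pow (q A : ℂ) {K k : ℕ} (hk : k ≤ K) :
    momFun q A K (X ^ k) = mom q A K k := by
  unfold momFun
  rw [Finset.sum_eq_single_of_mem k (Finset.mem_range.2 (by omega))]
  · simp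
  · intro j _ hj
    simp [coeff_X_pow, hj]

/-- A form of the `q`-Chu–Vandermonde sum: on the Newton basis the functional takes factorized
values, in which the factor `(r)_j` appears. -/
theorem momFun_nodePoly (q : ℂ) (j : ℕ) : ∀ (A : ℂ) (K : ℕ), j ≤ K →
    momFun q A K (nodePoly q j) =
      (∏ l ∈ Finset.range j, (C (-(q ^ l * A)) * (1 - C (q ^ l) * X))) *
        ∏ l ∈ Finset.Ico j K, (1 - C (q ^ l * A) * X) := by
  induction j with
  | zero =>
    intro A K _
    have : nodePoly q 0 = X ^ 0 := by simp [nodePoly]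
    rw [this, momFun_X_pow q A (Nat.zero_le K)]
    simp [mom]
  | succ j ih =>
    intro A K hK
    obtain ⟨K, rfl⟩ : ∃ K', K = K' + 1 := ⟨K - 1, by omega⟩
    have h1 : nodePoly q (j + 1) = X * nodePoly q j - C (q ^ j) * nodePoly q j := by
      rw [nodePoly, Finset.prod_range_succ, ← nodePoly]; ring
    rw [h1, momFun_sub, momFun_X_mul, momFun_C_mul, ih _ _ (by omega), ih _ _ (by omega),
      Finset.prod_eq_prod_Ico_succ_bot (show j < K + 1 by omega) (fun l => 1 - C (q ^ l * A) * X),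
      ← Finset.prod_Ico_add' _ j K 1, Finset.prod_range_succ]
    have h2 : ∏ l ∈ Finset.range j, (C (-(q ^ l * (q * A))) * (1 - C (q ^ l) * X)) =
        C (q ^ j) * ∏ l ∈ Finset.range j, (C (-(q ^ l * A)) * (1 - C (q ^ l) * X)) := by
      have : C (q ^ j) = ∏ _l ∈ Finset.range j, C q := by simp
      rw [this, ← Finset.prod_mul_distrib]
      refine Finset.prod_congr rfl fun l _ => ?_
      simp only [map_mul, map_neg]; ring
    rw [h2]
    simp only [pow_succ, map_mul, map_neg, map_sub, map_one, mul_assoc]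
    ring

/-- Expanding `g` in the Newton basis at the nodes `q^ν, q^{ν+1}, …` reduces the divisibility by
`(r)_ν` to `momFun_nodePoly`. -/
theorem dvd_momFun_nodePoly_mul (q A : ℂ) (d : ℕ) : ∀ (ν : ℕ) (g : ℂ[X]), g.natDegree ≤ d →
    (∏ l ∈ Finset.range ν, (1 - C (q ^ l) * X : ℂ[X])) ∣
      momFun q A (ν + d) (nodePoly q ν * g) := by
  have key : ∀ ν K : ℕ, ν ≤ K → (∏ l ∈ Finset.range ν, (1 - C (q ^ l) * X : ℂ[X])) ∣
      momFun q A K (nodePoly q ν) := by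
    intro ν K h
    rw [momFun_nodePoly q ν A K h, Finset.prod_mul_distrib, mul_assoc]
    exact Dvd.dvd.mul_left (Dvd.intro _ rfl) _
  induction d with
  | zero =>
    intro ν g hg
    rw [eq_C_of_natDegree_le_zero hg, mul_comm, momFun_C_mul]
    exact (key ν _ le_rfl).mul_left _
  | succ d ih =>
    intro ν g hg
    have h1 : nodePoly q ν * g = C (g.eval (q ^ ν)) * nodePoly q ν +
        nodePoly q (ν + 1) * (g /ₘ (X - C (q ^ ν))) := by
      have := modByMonic_add_div g (X - C (q ^ ν))
      rw [modByMonic_X_sub_C_eq_C_eval] at this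
      rw [nodePoly, nodePoly, Finset.prod_range_succ]
      nth_rw 1 [← this]
      ring
    rw [h1, momFun_add, momFun_C_mul]
    refine dvd_add ((key ν _ (by omega)).mul_left _) ?_
    have h2 := ih (ν + 1) (g /ₘ (X - C (q ^ ν))) (by
      rw [natDegree_divByMonic _ (monic_X_sub_C _), natDegree_X_sub_C]; omega)
    rw [show ν + (d + 1) = ν + 1 + d by ring]
    rw [Finset.prod_range_succ] at h2
    exact dvd_of_mul_right_dvd h2

/-- On polynomials of degree at most `K` the functional is a combination of evaluations at
`1, q, …, q^K`, and the mass at `q^ν` is divisible by `(r)_ν`. The masses are the values on the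
Lagrange basis. -/
theorem exists_mom_eq_sum (q A : ℂ) (hq : Function.Injective fun i : ℕ => q ^ i) (K : ℕ) :
    ∃ W : ℕ → ℂ[X], (∀ ν ≤ K, (∏ l ∈ Finset.range ν, (1 - C (q ^ l) * X : ℂ[X])) ∣ W ν) ∧
      ∀ k ≤ K, mom q A K k = ∑ ν ∈ Finset.range (K + 1), C ((q ^ ν) ^ k) * W ν := by
  have hinj : Set.InjOn (fun ν : ℕ => q ^ ν) (Finset.range (K + 1) : Finset ℕ) :=
    fun _ _ _ _ h => hq h
  refine ⟨fun ν => momFun q A K (Lagrange.basis (Finset.range (K + 1)) (fun ν : ℕ => q ^ ν) ν),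
    fun ν hν => ?_, fun k hk => ?_⟩
  · have hdvd : nodePoly q ν ∣ Lagrange.basis (Finset.range (K + 1)) (fun ν : ℕ => q ^ ν) ν := by
      unfold nodePoly Lagrange.basis
      refine (Finset.prod_dvd_prod_of_dvd _
        (fun l => Lagrange.basisDivisor (q ^ ν) (q ^ l)) ?_).trans
        (Finset.prod_dvd_prod_of_subset _ _ _ ?_)
      · intro l _
        exact Dvd.intro_left _ rfl
      · intro l hl
        simp only [Finset.mem_range, Finset.mem_erase] at hl ⊢
        omega
    obtain ⟨g, hg⟩ := hdvd
    have hdeg := Lagrange.natDegree_basis hinj (Finset.mem_range.2 (Nat.lt_succ_of_le hν))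
    have hne := Lagrange.basis_ne_zero hinj (Finset.mem_range.2 (Nat.lt_succ_of_le hν))
    simp only at hdeg hne ⊢
    rw [hg] at hdeg hne ⊢
    rw [natDegree_mul (left_ne_zero_of_mul hne) (right_ne_zero_of_mul hne)] at hdeg
    have hn : (nodePoly q ν).natDegree = ν := by
      rw [nodePoly, natDegree_prod_of_monic _ _ fun l _ => monic_X_sub_C _]
      simp only [natDegree_X_sub_C, Finset.sum_const, Finset.card_range, smul_eq_mul, mul_one]
    have := dvd_momFun_nodePoly_mul q A (K - ν) ν g (by simp at hdeg; omega)
    rwa [Nat.add_sub_cancel' hν] at this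
  · have h := Lagrange.eq_interpolate (f := (X : ℂ[X]) ^ k) hinj (by
      rw [degree_X_pow]; simp; exact_mod_cast Nat.lt_succ_of_le hk)
    rw [← momFun_X_pow q A hk, h, Lagrange.interpolate_apply, momFun_sum]
    refine Finset.sum_congr rfl fun ν _ => ?_
    rw [momFun_C_mul]; simp

end Moments

/-! ### The pair polynomial: exponents and zeros -/

open MvPolynomial in
/-- The polynomial `∏_{i<j} (z_i - z_j) ∏_{1-τ ≤ l ≤ τ-1} (z_i - q^l z_j)`. -/
noncomputable def pairPoly (q : ℂ) (τ n : ℕ) : MvPolynomial (Fin n) ℂ :=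
  ∏ i, ∏ j ∈ Finset.Ioi i,
    ((X i - X j) * ∏ l ∈ Finset.Icc (1 - (τ : ℤ)) (τ - 1), (X i - C (q ^ l) * X j))

open MvPolynomial in
theorem eval_pairPoly (q : ℂ) (τ n : ℕ) (z : Fin n → ℂ) :
    eval z (pairPoly q τ n) = ∏ i, ∏ j ∈ Finset.Ioi i,
      ((z i - z j) * ∏ l ∈ Finset.Icc (1 - (τ : ℤ)) (τ - 1), (z i - q ^ l * z j)) := by
  simp [pairPoly, map_prod]

/-- Twice the number of pairs `i < j` inside `S`, counted with weight `τ`. -/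
theorem sum_Ioi_ite_mem (τ n : ℕ) (S : Finset (Fin n)) :
    (∑ i, ∑ j ∈ Finset.Ioi i, if i ∈ S ∧ j ∈ S then 2 * τ else 0) =
      τ * (S.card * (S.card - 1)) := by
  have h := Finset.sum_sum_Ioi_add_eq_sum_sum_off_diag
    (fun j i : Fin n => if i ∈ S ∧ j ∈ S then τ else 0)
  have h1 : (∑ i, ∑ j ∈ Finset.Ioi i, if i ∈ S ∧ j ∈ S then 2 * τ else 0) =
      ∑ i : Fin n, ∑ j ∈ Finset.Ioi i,
        ((if i ∈ S ∧ j ∈ S then τ else 0) + (if j ∈ S ∧ i ∈ S then τ else 0)) := by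
    refine Finset.sum_congr rfl fun i _ => Finset.sum_congr rfl fun j _ => ?_
    by_cases hi : i ∈ S <;> by_cases hj : j ∈ S <;> simp [hi, hj, two_mul]
  rw [h1, h]
  have h2 : ∀ i, (∑ j ∈ ({i}ᶜ : Finset (Fin n)), if i ∈ S ∧ j ∈ S then τ else 0) =
      if i ∈ S then (S.card - 1) * τ else 0 := by
    intro i
    by_cases hi : i ∈ S
    · simp only [hi, true_and, if_true]
      rw [← Finset.sum_filter, Finset.sum_const, smul_eq_mul]
      congr 1
      rw [← Finset.card_erase_of_mem hi]
      congr 1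
      ext j; simp
    · simp [hi]
  simp only [h2]
  rw [← Finset.sum_filter]
  simp; ring

open MvPolynomial in
theorem pairPoly_isHomogeneous (q : ℂ) (τ n : ℕ) (hτ : 0 < τ) :
    (pairPoly q τ n).IsHomogeneous (τ * (n * (n - 1))) := by
  have h := sum_Ioi_ite_mem τ n Finset.univ
  simp only [Finset.mem_univ, and_self, if_true, Finset.card_univ, Fintype.card_fin] at h
  rw [← h]
  refine IsHomogeneous.prod _ _ _ fun i _ => IsHomogeneous.prod _ _ _ fun j _ => ?_
  have h2 : 2 * τ = 1 + ∑ l ∈ Finset.Icc (1 - (τ : ℤ)) (τ - 1), 1 := by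
    simp; omega
  rw [h2]
  refine IsHomogeneous.mul ((isHomogeneous_X _ _).sub (isHomogeneous_X _ _))
    (IsHomogeneous.prod _ _ _ fun l _ => ?_)
  refine (isHomogeneous_X _ _).sub ?_
  simpa using (isHomogeneous_C (Fin n) (q ^ l)).mul (isHomogeneous_X ℂ j)

open MvPolynomial in
theorem le_sum_of_mem_support_prod {σ ι : Type*} (S : Finset σ) (s : Finset ι)
    (p : ι → MvPolynomial σ ℂ) (a : ι → ℕ)
    (h : ∀ i ∈ s, ∀ m ∈ (p i).support, a i ≤ ∑ x ∈ S, m x) :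
    ∀ m ∈ (∏ i ∈ s, p i).support, ∑ i ∈ s, a i ≤ ∑ x ∈ S, m x := by
  classical
  induction s using Finset.induction_on with
  | empty => simp
  | insert b s hb ih =>
    intro m hm
    rw [Finset.prod_insert hb] at hm
    obtain ⟨m1, h1, m2, h2, rfl⟩ := Finset.mem_add.1 (support_mul _ _ hm)
    rw [Finset.sum_insert hb]
    simp only [Finsupp.add_apply, Finset.sum_add_distrib]
    exact add_le_add (h b (Finset.mem_insert_self _ _) m1 h1)
      (ih (fun i hi => h i (Finset.mem_insert_of_mem hi)) m2 h2)

open MvPolynomial in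
/-- Each pair inside `S` contributes degree `2τ` in the variables of `S` to every monomial. -/
theorem le_sum_of_mem_support_pairPoly (q : ℂ) (τ n : ℕ) (hτ : 0 < τ) (S : Finset (Fin n))
    (m : Fin n →₀ ℕ) (hm : m ∈ (pairPoly q τ n).support) :
    τ * (S.card * (S.card - 1)) ≤ ∑ i ∈ S, m i := by
  classical
  rw [← sum_Ioi_ite_mem]
  revert m
  refine le_sum_of_mem_support_prod S _ _ _ fun i _ => le_sum_of_mem_support_prod S _ _ _ ?_
  intro j _
  split_ifs with hij
  · have hlin : ∀ c : ℂ, ∀ m ∈ (X i - C c * X j : MvPolynomial (Fin n) ℂ).support,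
        1 ≤ ∑ x ∈ S, m x := by
      intro c m hm
      have h1 := support_sub (Fin n) _ _ hm
      rw [Finset.mem_union] at h1
      have h2 : m = Finsupp.single i 1 ∨ m = Finsupp.single j 1 := by
        rcases h1 with h1 | h1
        · left; simpa [support_X] using h1
        · right
          rw [C_mul_X_eq_monomial] at h1
          simpa using support_monomial_subset h1
      rcases h2 with rfl | rfl
      · exact (by simp : 1 ≤ Finsupp.single i 1 i).trans
          (Finset.single_le_sum (f := fun x => Finsupp.single i 1 x)
            (fun _ _ => Nat.zero_le _) hij.1)
      · exact (by simp : 1 ≤ Finsupp.single j 1 j).trans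
          (Finset.single_le_sum (f := fun x => Finsupp.single j 1 x)
            (fun _ _ => Nat.zero_le _) hij.2)
    intro m hm
    obtain ⟨m1, h1, m2, h2, rfl⟩ := Finset.mem_add.1 (support_mul _ _ hm)
    have h3 := hlin 1 m1 (by simpa using h1)
    have h4 := le_sum_of_mem_support_prod S _ _ (fun _ => 1) (fun l _ => hlin (q ^ l)) m2 h2
    simp only [Finsupp.add_apply, Finset.sum_add_distrib]
    rw [Finset.sum_const, Int.card_Icc, smul_eq_mul, mul_one] at h4
    omega
  · simp

open MvPolynomial in
theorem sum_of_mem_support_pairPoly (q : ℂ) (τ n : ℕ) (hτ : 0 < τ)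
    (m : Fin n →₀ ℕ) (hm : m ∈ (pairPoly q τ n).support) :
    ∑ i, m i = τ * (n * (n - 1)) := by
  have h := pairPoly_isHomogeneous q τ n hτ (mem_support_iff.1 hm)
  rw [← h, Finsupp.weight_apply, Finsupp.sum_fintype] <;> simp

/-- If every `S`-partial sum of `m` is at least `τ |S| (|S| - 1)`, with equality for the full set,
then the `j`-th smallest value is at most `(n + j - 1) τ`: the `n - j` largest values sum to at
most `τ (n (n - 1) - j (j - 1))`. -/
theorem exists_perm_le_of_majorized (τ n : ℕ) (m : Fin n → ℕ)
    (hS : ∀ S : Finset (Fin n), τ * (S.card * (S.card - 1)) ≤ ∑ i ∈ S, m i)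
    (hsum : ∑ i, m i = τ * (n * (n - 1))) :
    ∃ σ : Equiv.Perm (Fin n), ∀ j : Fin n, m (σ j) ≤ (n + j - 1) * τ := by
  classical
  refine ⟨Tuple.sort m, fun j => ?_⟩
  set σ := Tuple.sort m
  have hmono : Monotone (m ∘ σ) := Tuple.monotone_sort m
  -- the `j` smallest exponents have sum at least `τ j (j - 1)`, and the `n - j` others, of which
  -- `m (σ j)` is the least, make up the rest of the total
  have h1 := hS ((Finset.Iio j).map σ.toEmbedding)
  rw [Finset.card_map, Fin.card_Iio, Finset.sum_map] at h1
  have h2 : ∑ i ∈ Finset.Ici j, m (σ j) ≤ ∑ i ∈ Finset.Ici j, m (σ i) :=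
    Finset.sum_le_sum fun i hi => hmono (Finset.mem_Ici.1 hi)
  rw [Finset.sum_const, Fin.card_Ici, smul_eq_mul] at h2
  have h3 : ∑ i ∈ Finset.Iio j, m (σ i) + ∑ i ∈ Finset.Ici j, m (σ i) = ∑ i, m i := by
    rw [← Equiv.sum_comp σ m, ← Finset.sum_union]
    · congr 1; ext i; simp [lt_or_ge]
    · exact Finset.disjoint_left.2 fun i hi hi' => by
        simp at hi hi'; exact absurd hi (not_lt.2 hi')
  simp only [Equiv.coe_toEmbedding] at h1
  obtain ⟨d, hd⟩ : ∃ d, n = j + 1 + d := ⟨n - (j + 1), by omega⟩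
  have h4 : τ * (j * (j - 1)) + (n - j) * m (σ j) ≤ τ * (n * (n - 1)) := by omega
  generalize m (σ j) = M at *
  generalize (j : ℕ) = k at *
  subst hd
  have e1 : k + 1 + d - k = d + 1 := by omega
  have e2 : k + 1 + d - 1 = k + d := by omega
  have e3 : k + 1 + d + k - 1 = 2 * k + d := by omega
  rw [e1, e2] at h4
  rw [e3]
  have h5 : (d + 1) * M ≤ (d + 1) * ((2 * k + d) * τ) := by
    rcases k with _ | k
    · simp at h4 ⊢; nlinarith
    · simp only [Nat.add_sub_cancel] at h4; nlinarith
  exact Nat.le_of_mul_le_mul_left h5 (Nat.succ_pos d)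

theorem le_of_mem_support_pairPoly (q : ℂ) (τ n : ℕ) (hτ : 0 < τ)
    (m : Fin n →₀ ℕ) (hm : m ∈ (pairPoly q τ n).support) (i : Fin n) :
    m i ≤ 2 * (n - 1) * τ := by
  obtain ⟨σ, hσ⟩ := exists_perm_le_of_majorized τ n m
    (fun S => le_sum_of_mem_support_pairPoly q τ n hτ S m hm)
    (sum_of_mem_support_pairPoly q τ n hτ m hm)
  have h := hσ (σ.symm i)
  rw [Equiv.apply_symm_apply] at h
  refine h.trans (Nat.mul_le_mul_right _ ?_)
  have := (σ.symm i).isLt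
  omega

/-- If `|ν_i - ν_j| < τ`, the factor with `l = ν_i - ν_j` (up to the order of `i` and `j`)
vanishes. -/
theorem gap_of_eval_pairPoly_ne_zero (q : ℂ) (hq : q ≠ 0) (τ n : ℕ) (ν : Fin n → ℕ)
    (h : MvPolynomial.eval (fun i => q ^ ν i) (pairPoly q τ n) ≠ 0) (i j : Fin n) (hij : i ≠ j) :
    ν i + τ ≤ ν j ∨ ν j + τ ≤ ν i := by
  wlog hlt : i < j generalizing i j
  · exact (this j i hij.symm (lt_of_le_of_ne (not_lt.1 hlt) hij.symm)).symm
  by_contra hcon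
  push Not at hcon
  rw [eval_pairPoly] at h
  refine h (Finset.prod_eq_zero (Finset.mem_univ i) (Finset.prod_eq_zero (Finset.mem_Ioi.2 hlt) ?_))
  refine mul_eq_zero_of_right _ (Finset.prod_eq_zero (i := (ν i : ℤ) - ν j) ?_ ?_)
  · rw [Finset.mem_Icc]; omega
  · rw [zpow_sub₀ hq, zpow_natCast, zpow_natCast]
    field_simp
    simp

theorem exists_perm_gap (τ n : ℕ) (hτ : 0 < τ) (ν : Fin n → ℕ)
    (h : ∀ i j, i ≠ j → ν i + τ ≤ ν j ∨ ν j + τ ≤ ν i) :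
    ∃ σ : Equiv.Perm (Fin n), ∀ i j : Fin n, i ≤ j → ν (σ i) + (j - i) * τ ≤ ν (σ j) := by
  refine ⟨Tuple.sort ν, fun i j hij => ?_⟩
  set σ := Tuple.sort ν
  have hmono : Monotone (ν ∘ σ) := Tuple.monotone_sort ν
  obtain ⟨d, hd⟩ : ∃ d : ℕ, (j : ℕ) = i + d := ⟨j - i, by have := Fin.le_def.1 hij; omega⟩
  induction d generalizing j with
  | zero =>
    have : j = i := Fin.ext (by omega)
    subst this; simp
  | succ d ih =>
    have hj := j.isLt
    let j' : Fin n := ⟨i + d, by omega⟩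
    have h1 := ih j' (Fin.le_def.2 (by simp [j'])) rfl
    have hlt : j' < j := Fin.lt_def.2 (by simp [j']; omega)
    have h2 := hmono hlt.le
    simp only [Function.comp] at h2
    have h3 := h (σ j') (σ j) (fun e => hlt.ne (σ.injective e))
    have e1 : (j : ℕ) - i = d + 1 := by omega
    have e2 : (j' : ℕ) - i = d := by simp [j']
    rw [e2] at h1
    rw [e1, add_mul]
    omega

/-! ### Tensor powers of a functional, and divisibility of the Selberg polynomial -/

open MvPolynomial in
/-- The `n`-fold tensor power of the linear functional `z^k ↦ M k`, applied to a polynomial in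
`n` variables. -/
noncomputable def tensorFun {R : Type*} [CommRing R] [Algebra ℂ R] {n : ℕ} (M : ℕ → R)
    (p : MvPolynomial (Fin n) ℂ) : R :=
  ∑ m ∈ p.support, algebraMap ℂ R (p.coeff m) * ∏ i, M (m i)

theorem tensorFun_eq_sum_eval {R : Type*} [CommRing R] [Algebra ℂ R] {n : ℕ} (M W : ℕ → R)
    (y : ℕ → ℂ) (T : Finset ℕ) (p : MvPolynomial (Fin n) ℂ)
    (h : ∀ m ∈ p.support, ∀ i, M (m i) = ∑ ν ∈ T, algebraMap ℂ R (y ν ^ m i) * W ν) :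
    tensorFun M p = ∑ ν ∈ Fintype.piFinset fun _ : Fin n => T,
      algebraMap ℂ R (MvPolynomial.eval (fun i => y (ν i)) p) * ∏ i, W (ν i) := by
  have h1 : ∀ m ∈ p.support, algebraMap ℂ R (p.coeff m) * ∏ i, M (m i) =
      ∑ ν ∈ Fintype.piFinset fun _ : Fin n => T,
        algebraMap ℂ R (p.coeff m * ∏ i, y (ν i) ^ m i) * ∏ i, W (ν i) := by
    intro m hm
    rw [Finset.prod_congr rfl fun i _ => h m hm i, Finset.prod_univ_sum, Finset.mul_sum]
    refine Finset.sum_congr rfl fun ν _ => ?_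
    rw [Finset.prod_mul_distrib, map_mul, map_prod, mul_assoc]
  rw [tensorFun, Finset.sum_congr rfl h1, Finset.sum_comm]
  refine Finset.sum_congr rfl fun ν _ => ?_
  rw [MvPolynomial.eval_eq', map_sum, Finset.sum_mul]

theorem tensorFun_scale {n D : ℕ} (M M' : ℕ → ℂ) (c b : ℂ) (p : MvPolynomial (Fin n) ℂ)
    (hD : ∀ m ∈ p.support, ∑ i, m i = D)
    (h : ∀ m ∈ p.support, ∀ i, M (m i) = c * b ^ m i * M' (m i)) :
    tensorFun M p = c ^ n * b ^ D * tensorFun M' p := by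
  unfold tensorFun
  rw [Finset.mul_sum]
  refine Finset.sum_congr rfl fun m hm => ?_
  rw [Finset.prod_congr rfl fun i _ => h m hm i, Finset.prod_mul_distrib, Finset.prod_mul_distrib,
    Finset.prod_pow_eq_pow_sum, hD m hm]
  simp; ring

/-- The image of `pairPoly` under the tensor power of the moment functional, as a polynomial in
`r`. The bound `K = 2 (n - 1) τ` is the largest exponent of a single variable in `pairPoly`. -/
noncomputable def selbergPoly (q A : ℂ) (τ n : ℕ) : Polynomial ℂ :=
  tensorFun (mom q A (2 * (n - 1) * τ)) (pairPoly q τ n)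

open Polynomial in
theorem eval_selbergPoly (q A r : ℂ) (τ n : ℕ) :
    (selbergPoly q A τ n).eval r =
      tensorFun (fun k => (mom q A (2 * (n - 1) * τ) k).eval r) (pairPoly q τ n) := by
  simp [selbergPoly, tensorFun, eval_finsetSum, eval_prod, Polynomial.algebraMap_eq]

open Polynomial in
theorem eval_mom (q A r : ℂ) (K k : ℕ) :
    (mom q A K k).eval r =
      (∏ l ∈ Finset.range k, (1 - q ^ l * A)) * ∏ l ∈ Finset.Ico k K, (1 - q ^ l * A * r) := by
  simp [mom, eval_prod]

open Polynomial in
/-- The product `∏_j (r)_{jτ}`, a polynomial in `r`. -/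
noncomputable def gapFactor (q : ℂ) (τ n : ℕ) : ℂ[X] :=
  ∏ j : Fin n, ∏ l ∈ Finset.range (j * τ), (1 - C (q ^ l) * X)

open Polynomial in
/-- The product `∏_j ∏_{(n+j-1)τ ≤ l < K} (1 - q^l A r)`, a polynomial in `r`. -/
noncomputable def majorFactor (q A : ℂ) (τ n : ℕ) : ℂ[X] :=
  ∏ j : Fin n, ∏ l ∈ Finset.Ico ((n + j - 1) * τ) (2 * (n - 1) * τ), (1 - C (q ^ l * A) * X)

theorem gapFactor_dvd (q A : ℂ) (hq : Function.Injective fun i : ℕ => q ^ i) (hq0 : q ≠ 0)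
    (τ n : ℕ) (hτ : 0 < τ) : gapFactor q τ n ∣ selbergPoly q A τ n := by
  obtain ⟨W, hW, hmom⟩ := exists_mom_eq_sum q A hq (2 * (n - 1) * τ)
  rw [selbergPoly, tensorFun_eq_sum_eval _ W (fun ν => q ^ ν)
    (Finset.range (2 * (n - 1) * τ + 1)) (pairPoly q τ n)
    (fun m hm i => hmom _ (le_of_mem_support_pairPoly q τ n hτ m hm i))]
  refine Finset.dvd_sum fun ν hν => ?_
  by_cases h : MvPolynomial.eval (fun i => q ^ ν i) (pairPoly q τ n) = 0
  · rw [h, map_zero, zero_mul]; exact dvd_zero _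
  refine Dvd.dvd.mul_left ?_ _
  obtain ⟨σ, hσ⟩ := exists_perm_gap τ n hτ ν (gap_of_eval_pairPoly_ne_zero q hq0 τ n ν h)
  rw [← Equiv.prod_comp σ, gapFactor]
  refine Finset.prod_dvd_prod_of_dvd _ _ fun j _ => ?_
  have hj := j.isLt
  have h1 := hσ ⟨0, by omega⟩ j (Fin.le_def.2 (Nat.zero_le _))
  simp only [tsub_zero] at h1
  refine (Finset.prod_dvd_prod_of_subset _ _ _ (Finset.range_mono ?_)).trans (hW (ν (σ j)) ?_)
  · omega
  · have := Finset.mem_range.1 (Fintype.mem_piFinset.1 hν (σ j)); omega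

theorem majorFactor_dvd (q A : ℂ) (τ n : ℕ) (hτ : 0 < τ) :
    majorFactor q A τ n ∣ selbergPoly q A τ n := by
  refine Finset.dvd_sum fun m hm => Dvd.dvd.mul_left ?_ _
  obtain ⟨σ, hσ⟩ := exists_perm_le_of_majorized τ n m
    (fun S => le_sum_of_mem_support_pairPoly q τ n hτ S m hm)
    (sum_of_mem_support_pairPoly q τ n hτ m hm)
  rw [← Equiv.prod_comp σ, majorFactor]
  refine Finset.prod_dvd_prod_of_dvd _ _ fun j _ => Dvd.dvd.mul_left ?_ _
  exact Finset.prod_dvd_prod_of_subset _ _ _ (Finset.Ico_subset_Ico_left (hσ j))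

open Polynomial in
theorem natDegree_one_sub_C_mul_X_le (c : ℂ) : (1 - C c * X : ℂ[X]).natDegree ≤ 1 := by
  compute_degree

open Polynomial in
theorem natDegree_one_sub_C_mul_X {c : ℂ} (hc : c ≠ 0) : (1 - C c * X : ℂ[X]).natDegree = 1 := by
  compute_degree!

open Polynomial in
theorem natDegree_selbergPoly_le (q A : ℂ) (τ n : ℕ) (hτ : 0 < τ) :
    (selbergPoly q A τ n).natDegree ≤ τ * (n * (n - 1)) := by
  refine natDegree_sum_le_of_forall_le _ _ fun m hm => ?_
  rw [Polynomial.algebraMap_eq]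
  refine (natDegree_C_mul_le _ _).trans ((natDegree_prod_le _ _).trans ?_)
  have h1 : ∀ i, (mom q A (2 * (n - 1) * τ) (m i)).natDegree ≤ 2 * (n - 1) * τ - m i := by
    intro i
    refine (natDegree_C_mul_le _ _).trans ((natDegree_prod_le _ _).trans ?_)
    refine (Finset.sum_le_sum fun l _ => natDegree_one_sub_C_mul_X_le _).trans ?_
    simp
  refine (Finset.sum_le_sum fun i _ => h1 i).trans ?_
  have h2 : ∑ i, (2 * (n - 1) * τ - m i) + ∑ i, m i = n * (2 * (n - 1) * τ) := by
    rw [← Finset.sum_add_distrib, Finset.sum_congr rfl fun i _ =>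
      Nat.sub_add_cancel (le_of_mem_support_pairPoly q τ n hτ m hm i)]
    simp
  rw [sum_of_mem_support_pairPoly q τ n hτ m hm] at h2
  nlinarith

open Polynomial in
/-- The two factors together have the degree that bounds the degree of `selbergPoly`. -/
theorem natDegree_factors (q A : ℂ) (hq0 : q ≠ 0) (hA : A ≠ 0) (τ n : ℕ) :
    gapFactor q τ n * majorFactor q A τ n ≠ 0 ∧
    (gapFactor q τ n * majorFactor q A τ n).natDegree = τ * (n * (n - 1)) := by
  have hne : ∀ c : ℂ, (1 - C c * X : ℂ[X]) ≠ 0 := fun c h => by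
    have := congrArg (Polynomial.eval 0) h
    simp at this
  have h1 : gapFactor q τ n ≠ 0 :=
    Finset.prod_ne_zero_iff.2 fun j _ => Finset.prod_ne_zero_iff.2 fun l _ => hne _
  have h2 : majorFactor q A τ n ≠ 0 :=
    Finset.prod_ne_zero_iff.2 fun j _ => Finset.prod_ne_zero_iff.2 fun l _ => hne _
  refine ⟨mul_ne_zero h1 h2, ?_⟩
  rw [natDegree_mul h1 h2, gapFactor, majorFactor,
    natDegree_prod _ _ fun j _ => Finset.prod_ne_zero_iff.2 fun l _ => hne _,
    natDegree_prod _ _ fun j _ => Finset.prod_ne_zero_iff.2 fun l _ => hne _,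
    ← Finset.sum_add_distrib]
  have h3 : ∀ j : Fin n, (∏ l ∈ Finset.range (j * τ), (1 - C (q ^ l) * X : ℂ[X])).natDegree +
      (∏ l ∈ Finset.Ico ((n + j - 1) * τ) (2 * (n - 1) * τ),
        (1 - C (q ^ l * A) * X : ℂ[X])).natDegree = (n - 1) * τ := by
    intro j
    rw [natDegree_prod _ _ fun l _ => hne _, natDegree_prod _ _ fun l _ => hne _,
      Finset.sum_congr rfl fun l _ => natDegree_one_sub_C_mul_X (pow_ne_zero l hq0),
      Finset.sum_congr rfl fun l _ =>
        natDegree_one_sub_C_mul_X (mul_ne_zero (pow_ne_zero l hq0) hA)]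
    have hj := j.isLt
    simp only [Finset.sum_const, Finset.card_range, Nat.card_Ico, smul_eq_mul, mul_one]
    rw [← Nat.sub_mul, ← Nat.add_mul]
    congr 1
    omega
  rw [Finset.sum_congr rfl fun j _ => h3 j]
  simp; ring

open Polynomial in
theorem isCoprime_factors (q A : ℂ) (τ n : ℕ) (hA : ∀ l l' : ℕ, q ^ l ≠ q ^ l' * A) :
    IsCoprime (gapFactor q τ n) (majorFactor q A τ n) := by
  refine IsCoprime.prod_left fun j _ => IsCoprime.prod_left fun l _ =>
    IsCoprime.prod_right fun j' _ => IsCoprime.prod_right fun l' _ => ?_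
  have h := sub_ne_zero.2 (hA l l').symm
  refine ⟨C ((q ^ l' * A - q ^ l)⁻¹ * (q ^ l' * A)), C (-(q ^ l' * A - q ^ l)⁻¹ * q ^ l), ?_⟩
  have : (C ((q ^ l' * A - q ^ l)⁻¹ * (q ^ l' * A - q ^ l)) : ℂ[X]) = 1 := by
    rw [inv_mul_cancel₀ h, map_one]
  simp only [map_mul, map_neg, map_sub] at this ⊢
  linear_combination this

open Polynomial in
theorem exists_selbergPoly_eq (q A : ℂ) (hq : Function.Injective fun i : ℕ => q ^ i) (hq0 : q ≠ 0)
    (hA0 : A ≠ 0) (hA : ∀ l l' : ℕ, q ^ l ≠ q ^ l' * A) (τ n : ℕ) (hτ : 0 < τ) :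
    ∃ κ : ℂ, selbergPoly q A τ n = C κ * (gapFactor q τ n * majorFactor q A τ n) := by
  obtain ⟨u, hu⟩ := (isCoprime_factors q A τ n hA).mul_dvd (gapFactor_dvd q A hq hq0 τ n hτ)
    (majorFactor_dvd q A τ n hτ)
  obtain ⟨h1, h2⟩ := natDegree_factors q A hq0 hA0 τ n
  have h3 := natDegree_selbergPoly_le q A τ n hτ
  by_cases hu0 : u = 0
  · exact ⟨0, by rw [hu, hu0]; simp⟩
  rw [hu, natDegree_mul h1 hu0, h2] at h3
  refine ⟨u.coeff 0, ?_⟩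
  rw [hu, mul_comm]
  congr 1
  exact eq_C_of_natDegree_le_zero (by omega)

/-! ### Infinite `q`-products, the theta function and the `q`-binomial theorem -/

theorem norm_ofReal_base {q : ℝ} (hq0 : 0 < q) : ‖(q : ℂ)‖ = q := by
  rw [Complex.norm_real, Real.norm_of_nonneg hq0.le]

theorem norm_pow_mul_le {q : ℝ} (hq0 : 0 < q) (hq1 : q < 1) (i : ℕ) (a : ℂ) :
    ‖(q : ℂ) ^ i * a‖ ≤ ‖a‖ := by
  rw [norm_mul, norm_pow, norm_ofReal_base hq0]
  exact mul_le_of_le_one_left (norm_nonneg _) (pow_le_one₀ hq0.le hq1.le)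

theorem pow_mul_ne_one {q : ℝ} (hq0 : 0 < q) (hq1 : q < 1) (i : ℕ) {a : ℂ} (ha : ‖a‖ < 1) :
    (q : ℂ) ^ i * a ≠ 1 := fun h => by
  have h1 := norm_pow_mul_le hq0 hq1 i a
  rw [h, norm_one] at h1
  linarith

theorem one_sub_pow_succ_ne_zero {q : ℝ} (hq0 : 0 < q) (hq1 : q < 1) (l : ℕ) :
    1 - (q : ℂ) ^ (l + 1) ≠ 0 := fun h => by
  refine pow_mul_ne_one hq0 hq1 l (a := q) (by rwa [norm_ofReal_base hq0]) ?_
  rw [← pow_succ]; exact (sub_eq_zero.1 h).symm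

theorem qPoch_eq_one_sub_mul (q : ℝ) (hq0 : 0 < q) (hq1 : q < 1) (a : ℂ) :
    qPoch q a = (1 - a) * qPoch q (q * a) := by
  simpa using qPoch_eq_prod_mul q hq0 hq1 a 1

theorem tendsto_prod_qPoch (q : ℝ) (hq0 : 0 < q) (hq1 : q < 1) (a : ℂ) :
    Tendsto (fun N : ℕ => ∏ l ∈ Finset.range N, (1 - (q : ℂ) ^ l * a)) atTop (𝓝 (qPoch q a)) :=
  (qPoch_multipliable q hq0 hq1 a).hasProd.tendsto_prod_nat

/-- The infinite product is majorized by the one at the negative real number `-b`; this gives the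
dominating series for bilateral sums. -/
theorem norm_qPoch_le (q : ℝ) (hq0 : 0 < q) (hq1 : q < 1) {a : ℂ} {b : ℝ} (hab : ‖a‖ ≤ b) :
    ‖qPoch q a‖ ≤ ‖qPoch q (-(b : ℂ))‖ := by
  refine le_of_tendsto_of_tendsto' (tendsto_prod_qPoch q hq0 hq1 a).norm
    (tendsto_prod_qPoch q hq0 hq1 (-(b : ℂ))).norm fun N => ?_
  rw [norm_prod, norm_prod]
  refine Finset.prod_le_prod (fun _ _ => norm_nonneg _) fun l _ => ?_
  have h1 : (1 - (q : ℂ) ^ l * -(b : ℂ)) = ((1 + q ^ l * b : ℝ) : ℂ) := by push_cast; ring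
  have hb : 0 ≤ b := (norm_nonneg a).trans hab
  rw [h1, Complex.norm_real, Real.norm_of_nonneg (by positivity)]
  refine (norm_sub_le _ _).trans ?_
  rw [norm_one, norm_mul, norm_pow, Complex.norm_real, Real.norm_of_nonneg hq0.le]
  gcongr

theorem norm_qPoch_sub_one_le (q : ℝ) (hq0 : 0 < q) (hq1 : q < 1) (a : ℂ) :
    ‖qPoch q a - 1‖ ≤ Real.exp (‖a‖ * (1 - q)⁻¹) - 1 := by
  refine le_of_tendsto' ((tendsto_prod_qPoch q hq0 hq1 a).sub_const 1).norm fun N => ?_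
  have h := Finset.norm_prod_one_add_sub_one_le (Finset.range N) fun l => -((q : ℂ) ^ l * a)
  simp only [← sub_eq_add_neg] at h
  refine h.trans (sub_le_sub_right (Real.exp_le_exp.2 ?_) _)
  simp only [norm_neg, norm_mul, norm_pow, Complex.norm_real, Real.norm_of_nonneg hq0.le]
  rw [← Finset.sum_mul, mul_comm]
  refine mul_le_mul_of_nonneg_left ?_ (norm_nonneg _)
  rw [← tsum_geometric_of_lt_one hq0.le hq1]
  exact (summable_geometric_of_lt_one hq0.le hq1).sum_le_tsum _ fun _ _ => by positivity

theorem tendsto_pow_mul_zero (q : ℝ) (hq0 : 0 < q) (hq1 : q < 1) (a : ℂ) :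
    Tendsto (fun N : ℕ => (q : ℂ) ^ N * a) atTop (𝓝 0) := by
  have : ‖(q : ℂ)‖ < 1 := by rwa [Complex.norm_real, Real.norm_of_nonneg hq0.le]
  simpa using (tendsto_pow_atTop_nhds_zero_of_norm_lt_one this).mul_const a

theorem tendsto_qPoch_pow_mul (q : ℝ) (hq0 : 0 < q) (hq1 : q < 1) (a : ℂ) :
    Tendsto (fun N : ℕ => qPoch q ((q : ℂ) ^ N * a)) atTop (𝓝 1) := by
  rw [tendsto_iff_norm_sub_tendsto_zero]
  refine squeeze_zero (fun _ => norm_nonneg _) (fun N => norm_qPoch_sub_one_le q hq0 hq1 _) ?_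
  have h := (tendsto_pow_mul_zero q hq0 hq1 a).norm.mul_const (1 - q)⁻¹
  have h2 := ((Real.continuous_exp.tendsto _).comp h).sub_const 1
  simpa using h2

theorem qTheta_mul (q : ℝ) (hq0 : 0 < q) (hq1 : q < 1) {w : ℂ} (hw : w ≠ 0) :
    qTheta q (q * w) * (-w) = qTheta q w := by
  have hq : (q : ℂ) ≠ 0 := by exact_mod_cast hq0.ne'
  have e1 : (q : ℂ) / (q * w) = w⁻¹ := by field_simp
  have e2 : (q : ℂ) * w⁻¹ = q / w := by field_simp
  rw [qTheta, qTheta, e1, qPoch_eq_one_sub_mul q hq0 hq1 w, qPoch_eq_one_sub_mul q hq0 hq1 w⁻¹, e2]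
  field_simp
  ring

/-- Quasi-periodicity of the theta function. -/
theorem qTheta_pow_mul (q : ℝ) (hq0 : 0 < q) (hq1 : q < 1) {w : ℂ} (hw : w ≠ 0) (m : ℕ) :
    qTheta q (q ^ m * w) * ∏ l ∈ Finset.range m, (-((q : ℂ) ^ l * w)) = qTheta q w := by
  have hq : (q : ℂ) ≠ 0 := by exact_mod_cast hq0.ne'
  induction m with
  | zero => simp
  | succ m ih =>
    rw [Finset.prod_range_succ, ← ih,
      ← qTheta_mul q hq0 hq1 (mul_ne_zero (pow_ne_zero m hq) hw), pow_succ']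
    ring_nf

theorem qTheta_ne_zero (q : ℝ) (hq0 : 0 < q) (hq1 : q < 1) (a : ℂ) (ha0 : a ≠ 0)
    (ha : ∀ k : ℤ, a * (q : ℂ) ^ k ≠ 1) : qTheta q a ≠ 0 := by
  have hq : (q : ℂ) ≠ 0 := by exact_mod_cast hq0.ne'
  refine mul_ne_zero (qPoch_ne_zero q hq0 hq1 _ fun i h => ha i ?_)
    (qPoch_ne_zero q hq0 hq1 _ fun i h => ha (-(i + 1)) ?_)
  · rw [zpow_natCast, mul_comm]; exact h
  · rw [zpow_neg, mul_inv_eq_one₀ (zpow_ne_zero _ hq)]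
    rw [← mul_div_assoc, div_eq_one_iff_eq ha0] at h
    rw [← h]
    exact_mod_cast (pow_succ (q : ℂ) i).symm

theorem summable_of_ratio_tendsto {t c : ℕ → ℂ} {a : ℂ} (ha : ‖a‖ < 1)
    (hc : Tendsto c atTop (𝓝 a)) (h : ∀ᶠ n in atTop, t (n + 1) = c n * t n) : Summable t := by
  obtain ⟨r, h1, h2⟩ := exists_between ha
  refine summable_of_ratio_norm_eventually_le h2 ?_
  filter_upwards [h, hc.norm.eventually_le_const h1] with n hn hn'
  rw [hn, norm_mul]
  gcongr

/-- The `q`-binomial theorem `∑_k (a)_k / (q)_k z^k = (a z)_∞ / (z)_∞`. Both sides satisfy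
`F(z) (1 - z) = F(q z) (1 - a z)`, and they agree at `z = 0`. -/
theorem tsum_qBinomial (q : ℝ) (hq0 : 0 < q) (hq1 : q < 1) (a z : ℂ) (hz : ‖z‖ < 1) :
    (∑' k : ℕ, z ^ k * ∏ l ∈ Finset.range k, ((1 - (q : ℂ) ^ l * a) / (1 - (q : ℂ) ^ (l + 1)))) *
      qPoch q z = qPoch q (a * z) := by
  set c : ℕ → ℂ := fun k =>
    ∏ l ∈ Finset.range k, ((1 - (q : ℂ) ^ l * a) / (1 - (q : ℂ) ^ (l + 1))) with hc
  have hqn : ‖(q : ℂ)‖ = q := norm_ofReal_base hq0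
  have hne  := one_sub_pow_succ_ne_zero hq0 hq1
  have hrec : ∀ k, c (k + 1) * (1 - (q : ℂ) ^ (k + 1)) = c k * (1 - (q : ℂ) ^ k * a) := by
    intro k
    simp only [hc, Finset.prod_range_succ]
    rw [mul_assoc, div_mul_cancel₀ _ (hne k)]
  have hsum : ∀ w : ℂ, ‖w‖ < 1 → Summable fun k => w ^ k * c k := by
    intro w hw
    refine summable_of_ratio_tendsto (c := fun k =>
      w * ((1 - (q : ℂ) ^ k * a) / (1 - (q : ℂ) ^ k * q))) hw ?_ (Eventually.of_forall fun k => ?_)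
    · have h1 := (tendsto_pow_mul_zero q hq0 hq1 a).const_sub 1
      have h2 := (tendsto_pow_mul_zero q hq0 hq1 q).const_sub 1
      have h3 := (h1.div h2 (by simp)).const_mul w
      simpa using h3
    · have h1 := hrec k
      have h2 := hne k
      rw [pow_succ] at h1 h2
      have : c (k + 1) = c k * (1 - (q : ℂ) ^ k * a) / (1 - (q : ℂ) ^ k * q) := by
        rw [← h1]; field_simp
      rw [this, pow_succ]; ring
  set F : ℂ → ℂ := fun w => ∑' k, w ^ k * c k with hF
  have hstep : ∀ w : ℂ, ‖w‖ < 1 → F w * (1 - w) = F (q * w) * (1 - a * w) := by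
    intro w hw
    have hqw : ‖(q : ℂ) * w‖ < 1 := by
      rw [norm_mul, hqn]; nlinarith [norm_nonneg w]
    have e1 := (hsum w hw).tsum_eq_zero_add
    have e2 := (hsum _ hqw).tsum_eq_zero_add
    have s1 := (summable_nat_add_iff 1).2 (hsum w hw)
    have s2 := (summable_nat_add_iff 1).2 (hsum _ hqw)
    have e3 : F w - F (q * w) = w * (F w - a * F (q * w)) := by
      simp only [hF]
      nth_rw 1 [e1, e2]
      simp only [pow_zero, add_sub_add_left_eq_sub]
      rw [← Summable.tsum_sub s1 s2, ← tsum_mul_left (a := a),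
        ← Summable.tsum_sub (hsum w hw) ((hsum _ hqw).mul_left a), ← tsum_mul_left]
      refine tsum_congr fun k => ?_
      have := hrec k
      simp only [mul_pow, pow_succ] at this ⊢
      linear_combination w ^ k * w * this
    linear_combination e3
  have hiter : ∀ N : ℕ, F z * ∏ l ∈ Finset.range N, (1 - (q : ℂ) ^ l * z) =
      F ((q : ℂ) ^ N * z) * ∏ l ∈ Finset.range N, (1 - (q : ℂ) ^ l * (a * z)) := by
    intro N
    induction N with
    | zero => simp
    | succ N ih =>
      have h1 : ‖(q : ℂ) ^ N * z‖ < 1 := (norm_pow_mul_le hq0 hq1 N z).trans_lt hz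
      have h2 := hstep _ h1
      rw [Finset.prod_range_succ, Finset.prod_range_succ, ← mul_assoc, ih, pow_succ',
        mul_assoc (q : ℂ)]
      linear_combination (∏ l ∈ Finset.range N, (1 - (q : ℂ) ^ l * (a * z))) * h2
  have hlim : Tendsto (fun N : ℕ => F ((q : ℂ) ^ N * z)) atTop (𝓝 1) := by
    have h0 : ∑' k : ℕ, (0 : ℂ) ^ k * c k = 1 := by
      rw [tsum_eq_single 0 fun k hk => by simp [hk]]; simp [hc]
    rw [← h0]
    refine tendsto_tsum_of_dominated_convergence (hsum z hz).norm (fun k => ?_)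
      (Eventually.of_forall fun N k => ?_)
    · exact ((tendsto_pow_mul_zero q hq0 hq1 z).pow k).mul_const _
    · rw [norm_mul, norm_mul, norm_pow, norm_pow]
      gcongr
      exact norm_pow_mul_le hq0 hq1 N z
  have h1 := (tendsto_prod_qPoch q hq0 hq1 z).const_mul (F z)
  have h2 := hlim.mul (tendsto_prod_qPoch q hq0 hq1 (a * z))
  rw [one_mul] at h2
  exact tendsto_nhds_unique (h1.congr hiter) h2

/-! ### Ramanujan's bilateral sum -/

/-- The term `A^ν (v q^ν)_∞ / (u q^ν)_∞` of Ramanujan's bilateral series. -/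
noncomputable def psiTerm (q : ℝ) (u v A : ℂ) (ν : ℤ) : ℂ :=
  A ^ ν * (qPoch q (v * (q : ℂ) ^ ν) / qPoch q (u * (q : ℂ) ^ ν))

/-- The bilateral series `∑_{ν ∈ ℤ} A^ν (v q^ν)_∞ / (u q^ν)_∞`, which converges absolutely for
`|v / u| < |A| < 1` if no `u q^ν` equals `1`. -/
noncomputable def psi (q : ℝ) (u v A : ℂ) : ℂ := ∑' ν : ℤ, psiTerm q u v A ν

theorem qPoch_zpow_ne_zero (q : ℝ) (hq0 : 0 < q) (hq1 : q < 1) {u : ℂ}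
    (hu : ∀ k : ℤ, u * (q : ℂ) ^ k ≠ 1) (ν : ℤ) : qPoch q (u * (q : ℂ) ^ ν) ≠ 0 := by
  have hq : (q : ℂ) ≠ 0 := by exact_mod_cast hq0.ne'
  refine qPoch_ne_zero q hq0 hq1 _ fun i h => hu (ν + i) ?_
  rw [zpow_add₀ hq, zpow_natCast]; linear_combination h

theorem psiTerm_add_one (q : ℝ) (hq0 : 0 < q) (hq1 : q < 1) {u : ℂ}
    (hu : ∀ k : ℤ, u * (q : ℂ) ^ k ≠ 1) (v : ℂ) {A : ℂ} (hA : A ≠ 0) (ν : ℤ) :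
    psiTerm q u v A (ν + 1) * (1 - v * (q : ℂ) ^ ν) =
      A * (1 - u * (q : ℂ) ^ ν) * psiTerm q u v A ν := by
  have hq : (q : ℂ) ≠ 0 := by exact_mod_cast hq0.ne'
  have h1 := qPoch_zpow_ne_zero q hq0 hq1 hu ν
  have h2 := qPoch_zpow_ne_zero q hq0 hq1 hu (ν + 1)
  have e1 := qPoch_eq_one_sub_mul q hq0 hq1 (u * (q : ℂ) ^ ν)
  have e2 := qPoch_eq_one_sub_mul q hq0 hq1 (v * (q : ℂ) ^ ν)
  rw [show (q : ℂ) * (u * (q : ℂ) ^ ν) = u * (q : ℂ) ^ (ν + 1) by rw [zpow_add₀ hq]; simp; ring]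
    at e1
  rw [show (q : ℂ) * (v * (q : ℂ) ^ ν) = v * (q : ℂ) ^ (ν + 1) by rw [zpow_add₀ hq]; simp; ring]
    at e2
  have h3 : (1 - u * (q : ℂ) ^ ν) ≠ 0 := fun h => h1 (by rw [e1, h, zero_mul])
  rw [psiTerm, psiTerm, e1, e2, zpow_add₀ hA]
  field_simp

theorem summable_psiTerm (q : ℝ) (hq0 : 0 < q) (hq1 : q < 1) {u v A : ℂ}
    (hu : ∀ k : ℤ, u * (q : ℂ) ^ k ≠ 1) (hA : ‖A‖ < 1) (hv : ‖v‖ < ‖A * u‖) :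
    Summable (psiTerm q u v A) := by
  have hq : (q : ℂ) ≠ 0 := by exact_mod_cast hq0.ne'
  have hAu : A * u ≠ 0 := norm_pos_iff.1 ((norm_nonneg v).trans_lt hv)
  have hA0 := left_ne_zero_of_mul hAu
  refine Summable.of_nat_of_neg_add_one ?_ ?_
  · have h1 := (tendsto_pow_mul_zero q hq0 hq1 u).const_sub 1
    have h2 := (tendsto_pow_mul_zero q hq0 hq1 v).const_sub 1
    have h3 := (h1.div h2 (by simp)).const_mul A
    simp only [sub_zero, div_one, mul_one] at h3
    refine summable_of_ratio_tendsto hA h3 ?_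
    filter_upwards [h2.eventually_ne (show (1 : ℂ) - 0 ≠ 0 by simp)] with n hn
    have := psiTerm_add_one q hq0 hq1 hu v hA0 n
    rw [zpow_natCast, mul_comm v, mul_comm u] at this
    simp only [Pi.div_apply]
    push_cast
    field_simp
    linear_combination this
  · have h1 := (tendsto_pow_mul_zero q hq0 hq1 ((q : ℂ) ^ 2)).sub_const v
    have h2 := (tendsto_pow_mul_zero q hq0 hq1 ((q : ℂ) ^ 2)).sub_const u
    have hu0 : u ≠ 0 := right_ne_zero_of_mul hAu
    have h3 := (h1.div h2 (by simpa using hu0)).const_mul A⁻¹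
    refine summable_of_ratio_tendsto ?_ h3 ?_
    · rw [zero_sub, zero_sub, neg_div_neg_eq, ← div_eq_inv_mul, div_div, norm_div,
        mul_comm u, div_lt_one (norm_pos_iff.2 hAu)]
      exact hv
    · filter_upwards [h2.eventually_ne (show (0 : ℂ) - u ≠ 0 by simpa using hu0)] with n hn
      have := psiTerm_add_one q hq0 hq1 hu v hA0 (-((n + 1 : ℕ) + 1 : ℤ))
      have e : (q : ℂ) ^ (-((n + 1 : ℕ) + 1 : ℤ)) = ((q : ℂ) ^ n * (q : ℂ) ^ 2)⁻¹ := by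
        rw [zpow_neg, ← pow_add]; congr 1
      rw [e, show (-((n + 1 : ℕ) + 1 : ℤ) + 1) = -((n : ℤ) + 1) by push_cast; ring] at this
      have hn2 : (q : ℂ) ^ n * (q : ℂ) ^ 2 ≠ 0 := by positivity
      simp only [Pi.div_apply]
      field_simp at this ⊢
      linear_combination -this

/-- Writing `(v q^ν)_∞ = (1 - v q^ν) (q v q^ν)_∞` directly, and after the shift `ν ↦ ν + 1`,
expresses `psi q u v A` in two ways by the series with `q v` at `A` and at `q A`; the second of
these is eliminated. -/
theorem psi_contiguous (q : ℝ) (hq0 : 0 < q) (hq1 : q < 1) {u v A : ℂ}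
    (hu : ∀ k : ℤ, u * (q : ℂ) ^ k ≠ 1) (hA : ‖A‖ < 1) (hv : ‖v‖ < ‖A * u‖) :
    psi q u v A * (1 - v / (A * u)) = psi q u (q * v) A * (1 - v / u) := by
  have hq : (q : ℂ) ≠ 0 := by exact_mod_cast hq0.ne'
  have hqn : ‖(q : ℂ)‖ = q := norm_ofReal_base hq0
  have hAu : A * u ≠ 0 := norm_pos_iff.1 ((norm_nonneg v).trans_lt hv)
  have hA0 := left_ne_zero_of_mul hAu
  have hu0 := right_ne_zero_of_mul hAu
  have s1 : Summable (psiTerm q u (q * v) A) := summable_psiTerm q hq0 hq1 hu hA (by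
    rw [norm_mul, hqn]; nlinarith [norm_nonneg v])
  have s2 : Summable (psiTerm q u (q * v) (q * A)) := summable_psiTerm q hq0 hq1 hu
    (by rw [norm_mul, hqn]; nlinarith [norm_nonneg A])
    (by rw [mul_assoc, norm_mul, norm_mul _ (A * u), hqn]; exact mul_lt_mul_of_pos_left hv hq0)
  have e1 : ∀ ν : ℤ, psiTerm q u v A ν =
      psiTerm q u (q * v) A ν - v * psiTerm q u (q * v) (q * A) ν := by
    intro ν
    have h := qPoch_eq_one_sub_mul q hq0 hq1 (v * (q : ℂ) ^ ν)
    rw [← mul_assoc] at h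
    simp only [psiTerm, h, mul_zpow]
    ring
  have e2 : ∀ ν : ℤ, psiTerm q u v A (ν + 1) =
      A * psiTerm q u (q * v) A ν - A * u * psiTerm q u (q * v) (q * A) ν := by
    intro ν
    have h1 := qPoch_zpow_ne_zero q hq0 hq1 hu ν
    have h2 := qPoch_zpow_ne_zero q hq0 hq1 hu (ν + 1)
    have h := qPoch_eq_one_sub_mul q hq0 hq1 (u * (q : ℂ) ^ ν)
    have e3 : ∀ w : ℂ, w * (q : ℂ) ^ (ν + 1) = q * (w * (q : ℂ) ^ ν) := fun w => by
      rw [zpow_add₀ hq, zpow_one]; ring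
    simp only [psiTerm, mul_zpow, zpow_add₀ hA0, zpow_one, e3, ← mul_assoc] at h2 h ⊢
    rw [h] at h1 ⊢
    have h3 := left_ne_zero_of_mul h1
    have key : ∀ X Y s : ℂ, s ≠ 0 → Y ≠ 0 → X / Y = s * (X / (s * Y)) := by
      intros; field_simp
    rw [key (qPoch q (q * v * (q : ℂ) ^ ν)) _ _ h3 h2]
    ring
  have f1 : psi q u v A = psi q u (q * v) A - v * psi q u (q * v) (q * A) := by
    rw [psi, tsum_congr e1, Summable.tsum_sub s1 (s2.mul_left v), tsum_mul_left]; rfl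
  have f2 : psi q u v A = A * psi q u (q * v) A - A * u * psi q u (q * v) (q * A) := by
    rw [psi, ← (Equiv.addRight (1 : ℤ)).tsum_eq]
    simp only [Equiv.coe_addRight]
    rw [tsum_congr e2, Summable.tsum_sub (s1.mul_left A) (s2.mul_left _), tsum_mul_left,
      tsum_mul_left]
    rfl
  have g1 : A * u * (1 - v / (A * u)) = A * u - v := by field_simp
  have g2 : A * u * (1 - v / u) = A * u - A * v := by field_simp
  refine mul_left_cancel₀ hAu ?_
  linear_combination A * u * f1 - v * f2 + psi q u v A * g1 - psi q u (q * v) A * g2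

/-- The first-order recurrence in `A`, from the shift `ν ↦ ν + 1` of the summation index. -/
theorem psi_mul_left (q : ℝ) (hq0 : 0 < q) (hq1 : q < 1) {u v A : ℂ}
    (hu : ∀ k : ℤ, u * (q : ℂ) ^ k ≠ 1) (hA : ‖A‖ < 1) (hv : ‖v‖ < ‖q * A * u‖) :
    psi q u v A * (1 - A) = psi q u v (q * A) * (v / q - A * u) := by
  have hq : (q : ℂ) ≠ 0 := by exact_mod_cast hq0.ne'
  have hqn : ‖(q : ℂ)‖ = q := norm_ofReal_base hq0
  have hAu : q * A * u ≠ 0 := norm_pos_iff.1 ((norm_nonneg v).trans_lt hv)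
  have hA0 := right_ne_zero_of_mul (left_ne_zero_of_mul hAu)
  have s1 : Summable (psiTerm q u v A) := summable_psiTerm q hq0 hq1 hu hA (hv.trans_le (by
    rw [mul_assoc, norm_mul, hqn]; exact mul_le_of_le_one_left (norm_nonneg _) hq1.le))
  have s2 : Summable (psiTerm q u v (q * A)) := summable_psiTerm q hq0 hq1 hu
    (by rw [norm_mul, hqn]; nlinarith [norm_nonneg A]) hv
  have e2 : ∀ ν : ℤ, psiTerm q u v A (ν + 1) - v / q * psiTerm q u v (q * A) (ν + 1) =
      A * psiTerm q u v A ν - A * u * psiTerm q u v (q * A) ν := by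
    intro ν
    have h := psiTerm_add_one q hq0 hq1 hu v hA0 ν
    have e : ∀ ν, psiTerm q u v (q * A) ν = (q : ℂ) ^ ν * psiTerm q u v A ν := fun ν => by
      simp only [psiTerm, mul_zpow]; ring
    rw [e, e, zpow_add₀ hq, zpow_one]
    field_simp
    linear_combination h
  have f := (Equiv.addRight (1 : ℤ)).tsum_eq fun ν =>
    psiTerm q u v A ν - v / q * psiTerm q u v (q * A) ν
  simp only [Equiv.coe_addRight] at f
  rw [tsum_congr e2, Summable.tsum_sub (s1.mul_left A) (s2.mul_left _), tsum_mul_left,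
      tsum_mul_left, Summable.tsum_sub s1 (s2.mul_left _), tsum_mul_left] at f
  unfold psi
  linear_combination -f

/-- Iterating `psi_contiguous` moves `v` to `0`. -/
theorem psi_eq_psi_zero (q : ℝ) (hq0 : 0 < q) (hq1 : q < 1) {u v A : ℂ}
    (hu : ∀ k : ℤ, u * (q : ℂ) ^ k ≠ 1) (hA : ‖A‖ < 1) (hv : ‖v‖ < ‖A * u‖) :
    psi q u v A * qPoch q (v / (A * u)) = psi q u 0 A * qPoch q (v / u) := by
  have hqn : ‖(q : ℂ)‖ = q := norm_ofReal_base hq0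
  have hle : ∀ N : ℕ, ‖(q : ℂ) ^ N * v‖ ≤ ‖v‖ := fun N => norm_pow_mul_le hq0 hq1 N v
  have hiter : ∀ N : ℕ, psi q u v A * ∏ l ∈ Finset.range N, (1 - (q : ℂ) ^ l * (v / (A * u))) =
      psi q u ((q : ℂ) ^ N * v) A * ∏ l ∈ Finset.range N, (1 - (q : ℂ) ^ l * (v / u)) := by
    intro N
    induction N with
    | zero => simp
    | succ N ih =>
      have h := psi_contiguous q hq0 hq1 hu hA ((hle N).trans_lt hv)
      rw [← mul_assoc, ← pow_succ', mul_div_assoc, mul_div_assoc] at h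
      rw [Finset.prod_range_succ, Finset.prod_range_succ, ← mul_assoc, ih]
      linear_combination (∏ l ∈ Finset.range N, (1 - (q : ℂ) ^ l * (v / u))) * h
  have hlim : Tendsto (fun N : ℕ => psi q u ((q : ℂ) ^ N * v) A) atTop (𝓝 (psi q u 0 A)) := by
    have hs := (summable_psiTerm q hq0 hq1 (v := -(‖v‖ : ℂ)) hu hA
      (by rwa [norm_neg, Complex.norm_real, norm_norm])).norm
    refine tendsto_tsum_of_dominated_convergence hs (fun ν => ?_)
      (Eventually.of_forall fun N ν => ?_)
    · have h0 : qPoch q (0 * (q : ℂ) ^ ν) = 1 := by simp [qPoch]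
      unfold psiTerm
      rw [h0]
      simp only [mul_assoc]
      exact ((tendsto_qPoch_pow_mul q hq0 hq1 _).div_const _).const_mul _
    · unfold psiTerm
      rw [norm_mul, norm_mul, norm_div, norm_div]
      gcongr
      have h1 : (-(‖v‖ : ℂ)) * (q : ℂ) ^ ν = -((‖v‖ * q ^ ν : ℝ) : ℂ) := by push_cast; ring
      rw [h1]
      refine norm_qPoch_le q hq0 hq1 ?_
      rw [norm_mul, norm_zpow, hqn]
      exact mul_le_mul_of_nonneg_right (hle N) (by positivity)
  have h1 := (tendsto_prod_qPoch q hq0 hq1 (v / (A * u))).const_mul (psi q u v A)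
  exact tendsto_nhds_unique (h1.congr hiter)
    (hlim.mul (tendsto_prod_qPoch q hq0 hq1 (v / u)))

/-- For `v = q^{m+1}` the terms with `ν < -m` vanish and the series is a `q`-binomial one. -/
theorem psi_pow (q : ℝ) (hq0 : 0 < q) (hq1 : q < 1) {w A : ℂ} (m : ℕ)
    (hw : ∀ k : ℤ, w * (q : ℂ) ^ k ≠ 1) (hA : ‖A‖ < 1) (hA0 : A ≠ 0) :
    psi q ((q : ℂ) ^ m * w) ((q : ℂ) ^ (m + 1)) A * (A ^ m * qPoch q w * qPoch q A) =
      qPoch q q * qPoch q (w * A) := by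
  have hq : (q : ℂ) ≠ 0 := by exact_mod_cast hq0.ne'
  have hz : ∀ j : ℕ, qPoch q (((q : ℂ) ^ j)⁻¹) = 0 := fun j => by
    rw [qPoch_eq_prod_mul q hq0 hq1 _ (j + 1), Finset.prod_range_succ,
      mul_inv_cancel₀ (pow_ne_zero _ hq)]
    simp
  have hw0 := qPoch_zpow_ne_zero q hq0 hq1 hw 0
  rw [zpow_zero, mul_one] at hw0
  have hqn : ‖(q : ℂ)‖ = q := norm_ofReal_base hq0
  have hne  := one_sub_pow_succ_ne_zero hq0 hq1
  rw [psi, ← (Equiv.addRight (-(m : ℤ))).tsum_eq]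
  have hv : ∀ ν : ℤ, (q : ℂ) ^ (m + 1) * (q : ℂ) ^ (ν + -(m : ℤ)) = (q : ℂ) ^ (ν + 1) := fun ν => by
    rw [← zpow_natCast, ← zpow_add₀ hq]; congr 1; push_cast; ring
  have hu : ∀ ν : ℤ, (q : ℂ) ^ m * w * (q : ℂ) ^ (ν + -(m : ℤ)) = w * (q : ℂ) ^ ν := fun ν => by
    rw [← zpow_natCast, mul_comm _ w, mul_assoc, ← zpow_add₀ hq]; congr 2; ring
  have hsupp : Function.support (fun ν : ℤ => psiTerm q ((q : ℂ) ^ m * w) ((q : ℂ) ^ (m + 1)) A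
      (Equiv.addRight (-(m : ℤ)) ν)) ⊆ Set.range ((↑) : ℕ → ℤ) := by
    intro ν hν
    by_contra hcon
    have hneg : ν < 0 := by
      by_contra h
      exact hcon ⟨ν.toNat, by omega⟩
    apply hν
    obtain ⟨j, hj⟩ : ∃ j : ℕ, ν + 1 = -(j : ℤ) := ⟨(-(ν + 1)).toNat, by omega⟩
    simp only [psiTerm, Equiv.coe_addRight, hv, hj, zpow_neg, zpow_natCast, hz]
    simp
  rw [← (Nat.cast_injective (R := ℤ)).tsum_eq hsupp]
  have hterm : ∀ k : ℕ, psiTerm q ((q : ℂ) ^ m * w) ((q : ℂ) ^ (m + 1)) A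
      (Equiv.addRight (-(m : ℤ)) (k : ℤ)) = (A ^ m)⁻¹ * (qPoch q q / qPoch q w) *
      (A ^ k * ∏ l ∈ Finset.range k, ((1 - (q : ℂ) ^ l * w) / (1 - (q : ℂ) ^ (l + 1)))) := by
    intro k
    have h1 := qPoch_eq_prod_mul q hq0 hq1 w k
    have h2 := qPoch_eq_prod_mul q hq0 hq1 q k
    have h3 := qPoch_zpow_ne_zero q hq0 hq1 hw k
    simp only [psiTerm, Equiv.coe_addRight, hv, hu, zpow_add₀ hA0, zpow_neg, zpow_natCast,
      Finset.prod_div_distrib] at h3 ⊢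
    have h4 : ∏ l ∈ Finset.range k, (1 - (q : ℂ) ^ (l + 1)) ≠ 0 :=
      Finset.prod_ne_zero_iff.2 fun l _ => hne l
    simp only [← pow_succ] at h2
    rw [mul_comm _ w] at h1
    rw [h1] at hw0
    have h5 := left_ne_zero_of_mul hw0
    rw [h1, h2, show (k : ℤ) + 1 = ((k + 1 : ℕ) : ℤ) by push_cast; rfl, zpow_natCast]
    generalize ∏ l ∈ Finset.range k, (1 - (q : ℂ) ^ l * w) = s at h5 ⊢
    field_simp
  rw [tsum_congr hterm, tsum_mul_left, mul_comm w A, mul_comm A w,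
    ← tsum_qBinomial q hq0 hq1 w A hA]
  generalize (∑' k : ℕ, A ^ k *
    ∏ l ∈ Finset.range k, ((1 - (q : ℂ) ^ l * w) / (1 - (q : ℂ) ^ (l + 1)))) = T
  field_simp

/-- Ramanujan's `₁ψ₁` summation, with denominators cleared. By `psi_eq_psi_zero` the dependence on
`v` is known, so it suffices to know the sum at `v = q^{m+1}` for one large `m`, which is
`psi_pow`. -/
theorem psi_eq (q : ℝ) (hq0 : 0 < q) (hq1 : q < 1) {u v A : ℂ}
    (hu : ∀ k : ℤ, u * (q : ℂ) ^ k ≠ 1) (hA : ‖A‖ < 1) (hv : ‖v‖ < ‖A * u‖) :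
    psi q u v A * (qPoch q (v / (A * u)) * qPoch q A * qTheta q u) =
      qPoch q q * qPoch q (v / u) * qTheta q (A * u) := by
  have hq : (q : ℂ) ≠ 0 := by exact_mod_cast hq0.ne'
  have hqn : ‖(q : ℂ)‖ = q := norm_ofReal_base hq0
  have hAu : A * u ≠ 0 := norm_pos_iff.1 ((norm_nonneg v).trans_lt hv)
  have hA0 := left_ne_zero_of_mul hAu
  have hu0 := right_ne_zero_of_mul hAu
  have hlim := (tendsto_pow_mul_zero q hq0 hq1 q).norm
  rw [norm_zero] at hlim
  -- `m` is so large that the series with `v = q^{m+1}` converges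
  obtain ⟨m, hm⟩ := (hlim.eventually_lt_const (norm_pos_iff.2 hAu)).exists
  rw [← pow_succ] at hm
  have h1 := psi_eq_psi_zero q hq0 hq1 hu hA hm
  have hqm : (q : ℂ) ^ m ≠ 0 := pow_ne_zero m hq
  set w := u / (q : ℂ) ^ m with hw
  have huw : u = (q : ℂ) ^ m * w := by rw [hw]; field_simp
  have hw0 : w ≠ 0 := div_ne_zero hu0 hqm
  have hwk : ∀ k : ℤ, w * (q : ℂ) ^ k ≠ 1 := fun k h => hu (k - m) (by
    rw [huw, zpow_sub₀ hq, zpow_natCast]; field_simp; exact h)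
  have h2 := psi_pow q hq0 hq1 m hwk hA hA0
  rw [← huw] at h2
  have e1 : (q : ℂ) ^ (m + 1) / u = q / w := by rw [huw, pow_succ]; field_simp
  have e2 : (q : ℂ) ^ (m + 1) / (A * u) = q / (A * w) := by rw [huw, pow_succ]; field_simp
  rw [e1, e2] at h1
  have t1 := qTheta_pow_mul q hq0 hq1 hw0 m
  have t2 := qTheta_pow_mul q hq0 hq1 (mul_ne_zero hA0 hw0) m
  rw [show (q : ℂ) ^ m * (A * w) = A * u by rw [huw]; ring] at t2
  rw [← huw] at t1
  have t3 : ∏ l ∈ Finset.range m, (-((q : ℂ) ^ l * (A * w))) =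
      A ^ m * ∏ l ∈ Finset.range m, (-((q : ℂ) ^ l * w)) := by
    simp only [show ∀ l : ℕ, -((q : ℂ) ^ l * (A * w)) = A * -((q : ℂ) ^ l * w) from
      fun l => by ring, Finset.prod_mul_distrib, Finset.prod_const, Finset.card_range]
  have hc : ∏ l ∈ Finset.range m, (-((q : ℂ) ^ l * w)) ≠ 0 :=
    Finset.prod_ne_zero_iff.2 fun l _ => neg_ne_zero.2 (mul_ne_zero (pow_ne_zero l hq) hw0)
  rw [t3] at t2
  have key : psi q u 0 A * qPoch q A * qTheta q u = qPoch q q * qTheta q (A * u) := by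
    have hAm : A ^ m ≠ 0 := pow_ne_zero m hA0
    refine mul_right_cancel₀ (mul_ne_zero hAm hc) ?_
    have h4 : psi q u 0 A * qPoch q A * (A ^ m * qTheta q w) = qPoch q q * qTheta q (A * w) := by
      rw [qTheta, qTheta]
      rw [mul_comm w A] at h2
      linear_combination (-(A ^ m * qPoch q A * qPoch q w)) * h1 + qPoch q (q / (A * w)) * h2
    linear_combination h4 + psi q u 0 A * qPoch q A * A ^ m * t1 - qPoch q q * t2
  have h3 := psi_eq_psi_zero q hq0 hq1 hu hA hv
  linear_combination qPoch q A * qTheta q u * h3 + qPoch q (v / u) * key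

/-! ### Evaluation of the Selberg polynomial -/

/-- The product is antisymmetric: the factors for `l` and `-l` together are symmetric, and `l = 0`
is left over. -/
theorem prod_Icc_sub_swap (q : ℂ) (hq : q ≠ 0) (τ : ℕ) (hτ : 0 < τ) (a b : ℂ) :
    ∏ l ∈ Finset.Icc (1 - (τ : ℤ)) (τ - 1), (a - q ^ l * b) =
      -∏ l ∈ Finset.Icc (1 - (τ : ℤ)) (τ - 1), (b - q ^ l * a) := by
  induction τ, hτ using Nat.le_induction with
  | base => simp
  | succ τ hτ ih =>
    have hI : Finset.Icc (1 - ((τ + 1 : ℕ) : ℤ)) ((τ + 1 : ℕ) - 1) =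
        insert (τ : ℤ) (insert (-(τ : ℤ)) (Finset.Icc (1 - (τ : ℤ)) (τ - 1))) := by
      ext l; simp only [Finset.mem_Icc, Finset.mem_insert]; omega
    have h1 : -(τ : ℤ) ∉ Finset.Icc (1 - (τ : ℤ)) (τ - 1) := by simp
    have h2 : (τ : ℤ) ∉ insert (-(τ : ℤ)) (Finset.Icc (1 - (τ : ℤ)) (τ - 1)) := by
      simp only [Finset.mem_Icc, Finset.mem_insert]; omega
    rw [hI, Finset.prod_insert h2, Finset.prod_insert h1, Finset.prod_insert h2,
      Finset.prod_insert h1, ih, zpow_neg]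
    have := zpow_ne_zero (τ : ℤ) hq
    field_simp
    ring

theorem eval_pairPoly_perm (q : ℂ) (hq : q ≠ 0) (τ n : ℕ) (hτ : 0 < τ) (z : Fin n → ℂ)
    (σ : Equiv.Perm (Fin n)) :
    MvPolynomial.eval (fun i => z (σ i)) (pairPoly q τ n) =
      MvPolynomial.eval z (pairPoly q τ n) := by
  rw [eval_pairPoly, eval_pairPoly]
  simp only [Finset.prod_mul_distrib]
  rw [Equiv.Perm.prod_Ioi_comp_eq_sign_mul_prod σ (f := fun i j => z i - z j) (fun i j => by ring),
    Equiv.Perm.prod_Ioi_comp_eq_sign_mul_prod σ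
      (f := fun i j => ∏ l ∈ Finset.Icc (1 - (τ : ℤ)) (τ - 1), (z i - q ^ l * z j))
      (fun i j => prod_Icc_sub_swap q hq τ hτ _ _)]
  have : ((σ.sign : ℤ) : ℂ) * ((σ.sign : ℤ) : ℂ) = 1 := by
    rcases Int.units_eq_one_or σ.sign with h | h <;> simp [h]
  linear_combination (∏ i, ∏ j ∈ Finset.Ioi i, (z i - z j)) *
    (∏ i, ∏ j ∈ Finset.Ioi i, ∏ l ∈ Finset.Icc (1 - (τ : ℤ)) (τ - 1), (z i - q ^ l * z j)) * this

/-- Among exponents at most `(n - 1) τ`, only the permutations of `(0, τ, …, (n - 1) τ)` have all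
gaps at least `τ`, and they contribute equally by symmetry. -/
theorem sum_eval_pairPoly (q : ℂ) (hq : q ≠ 0) (τ n : ℕ) (hτ : 0 < τ) (W : ℕ → ℂ) :
    ∑ ν ∈ Fintype.piFinset fun _ : Fin n => Finset.range ((n - 1) * τ + 1),
      MvPolynomial.eval (fun i => q ^ ν i) (pairPoly q τ n) * ∏ i, W (ν i) =
    n.factorial * (MvPolynomial.eval (fun i : Fin n => q ^ (i * τ : ℕ)) (pairPoly q τ n) *
      ∏ i : Fin n, W (i * τ)) := by
  classical
  let f : Equiv.Perm (Fin n) → Fin n → ℕ := fun σ i => σ i * τ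
  have hf : Function.Injective f := fun σ σ' h => Equiv.ext fun i => Fin.ext
    (Nat.eq_of_mul_eq_mul_right hτ (congrFun h i))
  have hsub : Finset.univ.image f ⊆
      Fintype.piFinset fun _ : Fin n => Finset.range ((n - 1) * τ + 1) := by
    intro ν hν
    obtain ⟨σ, _, rfl⟩ := Finset.mem_image.1 hν
    refine Fintype.mem_piFinset.2 fun i => Finset.mem_range.2 (Nat.lt_succ_of_le ?_)
    exact Nat.mul_le_mul_right _ (by have := (σ i).isLt; omega)
  rw [← Finset.sum_subset hsub, Finset.sum_image fun _ _ _ _ h => hf h]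
  · have h1 : ∀ σ : Equiv.Perm (Fin n),
        MvPolynomial.eval (fun i => q ^ f σ i) (pairPoly q τ n) * ∏ i, W (f σ i) =
        MvPolynomial.eval (fun i : Fin n => q ^ (i * τ : ℕ)) (pairPoly q τ n) *
          ∏ i : Fin n, W (i * τ) := by
      intro σ
      rw [← eval_pairPoly_perm q hq τ n hτ (fun i : Fin n => q ^ (i * τ : ℕ)) σ,
        ← Equiv.prod_comp σ fun i : Fin n => W (i * τ)]
    rw [Finset.sum_congr rfl fun σ _ => h1 σ]
    simp [Fintype.card_perm]
  · intro ν hν hν'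
    by_contra hcon
    obtain ⟨σ, hσ⟩ := exists_perm_gap τ n hτ ν
      (gap_of_eval_pairPoly_ne_zero q hq τ n ν (left_ne_zero_of_mul hcon))
    refine hν' (Finset.mem_image.2 ⟨σ.symm, Finset.mem_univ _, funext fun i => ?_⟩)
    have hj := (σ.symm i).isLt
    have h1 := hσ ⟨0, by omega⟩ (σ.symm i) (Fin.le_def.2 (Nat.zero_le _))
    have h2 := hσ (σ.symm i) ⟨n - 1, by omega⟩ (Fin.le_def.2 (by simp; omega))
    have h3 := Finset.mem_range.1 (Fintype.mem_piFinset.1 hν (σ ⟨n - 1, by omega⟩))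
    simp only [tsub_zero, Equiv.apply_symm_apply] at h1 h2
    obtain ⟨d, hd⟩ : ∃ d, n - 1 = σ.symm i + d := ⟨n - 1 - σ.symm i, by omega⟩
    have e1 : n - 1 - (σ.symm i : ℕ) = d := by omega
    have e2 : (n - 1) * τ = σ.symm i * τ + d * τ := by rw [hd, add_mul]
    rw [e1] at h2
    simp only [f]
    omega

/-- Both sides are the product over the union, with multiplicity, of the same two intervals. -/
theorem prod_Ico_exchange (f : ℕ → ℂ) {N k : ℕ} (hk : k ≤ 2 * N) :
    (∏ l ∈ Finset.Ico N (k + N), f l) * ∏ l ∈ Finset.Ico k (2 * N), f l =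
      (∏ l ∈ Finset.Ico N (2 * N), f l) * ∏ l ∈ Finset.Ico k (k + N), f l := by
  rcases le_total k N with h | h
  · rw [← Finset.prod_Ico_consecutive f (show k ≤ k + N by omega) (show k + N ≤ 2 * N by omega),
      ← Finset.prod_Ico_consecutive f (show N ≤ k + N by omega) (show k + N ≤ 2 * N by omega)]
    ring
  · rw [← Finset.prod_Ico_consecutive f (show N ≤ 2 * N by omega) (show 2 * N ≤ k + N by omega),
      ← Finset.prod_Ico_consecutive f hk (show 2 * N ≤ k + N by omega)]
    ring

/-- At `r = q^{-N}` the functional is carried by `1, q, …, q^N`, with masses given by the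
terminating `q`-binomial theorem. -/
theorem eval_mom_inv_pow (q : ℝ) (hq0 : 0 < q) (hq1 : q < 1) (A : ℂ) (hA : ‖A‖ < 1) (N k : ℕ)
    (hk : k ≤ 2 * N) :
    (mom q A (2 * N) k).eval (((q : ℂ) ^ N)⁻¹) = ∑ ν ∈ Finset.range (N + 1), ((q : ℂ) ^ ν) ^ k *
      ((∏ l ∈ Finset.range N, (1 - (q : ℂ) ^ l * A)) * (A ^ ν * ∏ l ∈ Finset.range ν,
        ((1 - (q : ℂ) ^ l * ((q : ℂ) ^ N)⁻¹) / (1 - (q : ℂ) ^ (l + 1))))) := by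
  have hq : (q : ℂ) ≠ 0 := by exact_mod_cast hq0.ne'
  have hqN := pow_ne_zero N hq
  set B := A * ((q : ℂ) ^ N)⁻¹ with hB
  have hAB : A = (q : ℂ) ^ N * B := by rw [hB]; field_simp
  have hz : ‖A * (q : ℂ) ^ k‖ < 1 := by
    rw [mul_comm]; exact (norm_pow_mul_le hq0 hq1 k A).trans_lt hA
  have hqb := tsum_qBinomial q hq0 hq1 ((q : ℂ) ^ N)⁻¹ (A * (q : ℂ) ^ k) hz
  rw [tsum_eq_sum (s := Finset.range (N + 1)) (by
    intro ν hν
    rw [Finset.mem_range, not_lt] at hν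
    refine mul_eq_zero_of_right _
      (Finset.prod_eq_zero (Finset.mem_range.2 (show N < ν by omega)) ?_)
    rw [mul_inv_cancel₀ hqN]; simp)] at hqb
  have hPz : qPoch q (A * (q : ℂ) ^ k) ≠ 0 := qPoch_ne_zero q hq0 hq1 _ fun i =>
    pow_mul_ne_one hq0 hq1 i hz
  rw [qPoch_eq_prod_mul q hq0 hq1 (((q : ℂ) ^ N)⁻¹ * (A * (q : ℂ) ^ k)) N,
    show (q : ℂ) ^ N * (((q : ℂ) ^ N)⁻¹ * (A * (q : ℂ) ^ k)) = A * (q : ℂ) ^ k by field_simp] at hqb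
  have hqb := mul_right_cancel₀ hPz hqb
  have e1 : ∏ l ∈ Finset.range N, (1 - (q : ℂ) ^ l * (((q : ℂ) ^ N)⁻¹ * (A * (q : ℂ) ^ k))) =
      ∏ l ∈ Finset.Ico k (k + N), (1 - (q : ℂ) ^ l * B) := by
    rw [Finset.prod_Ico_eq_prod_range, Nat.add_sub_cancel_left]
    exact Finset.prod_congr rfl fun l _ => by rw [hB, pow_add]; ring
  have e2 : ∀ j : ℕ, ∏ l ∈ Finset.range j, (1 - (q : ℂ) ^ l * A) =
      ∏ l ∈ Finset.Ico N (j + N), (1 - (q : ℂ) ^ l * B) := by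
    intro j
    rw [Finset.prod_Ico_eq_prod_range, Nat.add_sub_cancel]
    exact Finset.prod_congr rfl fun l _ => by rw [hAB, pow_add]; ring
  have e3 := prod_Ico_exchange (fun l => 1 - (q : ℂ) ^ l * B) hk
  rw [eval_mom, e2 k]
  simp only [mul_assoc, ← hB]
  have e4 := e2 N
  rw [← two_mul] at e4
  rw [e3, ← e1, ← hqb, ← e4, Finset.mul_sum]
  refine Finset.sum_congr rfl fun ν _ => ?_
  rw [mul_pow, ← pow_mul, ← pow_mul, mul_comm k ν]
  ring

theorem eval_gapFactor (q r : ℂ) (τ n : ℕ) : (gapFactor q τ n).eval r =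
    ∏ j : Fin n, ∏ l ∈ Finset.range (j * τ), (1 - q ^ l * r) := by
  simp [gapFactor, Polynomial.eval_prod]

theorem eval_majorFactor (q A r : ℂ) (τ n : ℕ) : (majorFactor q A τ n).eval r =
    ∏ j : Fin n, ∏ l ∈ Finset.Ico ((n + j - 1) * τ) (2 * (n - 1) * τ), (1 - q ^ l * A * r) := by
  simp [majorFactor, Polynomial.eval_prod]

/-- For `A` outside `q^ℤ` the two factors of `selbergPoly` are coprime, and the constant is found at
`r = q^{-(n-1)τ}`. -/
theorem eval_selbergPoly_of_generic (q : ℝ) (hq0 : 0 < q) (hq1 : q < 1) (A r : ℂ) (hA : ‖A‖ < 1)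
    (hA0 : A ≠ 0) (hAq : ∀ k : ℤ, A ≠ (q : ℂ) ^ k) (τ n : ℕ) (hτ : 0 < τ) :
    (selbergPoly q A τ n).eval r = n.factorial *
      (MvPolynomial.eval (fun i : Fin n => (q : ℂ) ^ (i * τ : ℕ)) (pairPoly q τ n) *
      ∏ j : Fin n, (A ^ (j * τ : ℕ) * (∏ l ∈ Finset.range (j * τ), (1 - (q : ℂ) ^ l * A)) *
        (∏ l ∈ Finset.range (j * τ), (1 - (q : ℂ) ^ l * r)) *
        (∏ l ∈ Finset.Ico ((n + j - 1) * τ) (2 * (n - 1) * τ), (1 - (q : ℂ) ^ l * A * r)) /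
        ∏ l ∈ Finset.range (j * τ), (1 - (q : ℂ) ^ (l + 1)))) := by
  have hq : (q : ℂ) ≠ 0 := by exact_mod_cast hq0.ne'
  have hqinj : Function.Injective fun i : ℕ => (q : ℂ) ^ i := fun i j h => by
    have h' : (q : ℂ) ^ i = (q : ℂ) ^ j := h
    exact pow_right_injective₀ hq0 hq1.ne (by exact_mod_cast h')
  have hAll : ∀ l l' : ℕ, (q : ℂ) ^ l ≠ (q : ℂ) ^ l' * A := fun l l' h => hAq (l - l') (by
    rw [zpow_sub₀ hq, zpow_natCast, zpow_natCast, h]; field_simp)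
  obtain ⟨κ, hκ⟩ := exists_selbergPoly_eq q A hqinj hq hA0 hAll τ n hτ
  set N := (n - 1) * τ with hN
  have hK : 2 * (n - 1) * τ = 2 * N := by rw [hN, mul_assoc]
  have hqN := pow_ne_zero N hq
  -- evaluation at `r = q^{-N}`
  have hev : (selbergPoly q A τ n).eval (((q : ℂ) ^ N)⁻¹) = _ := eval_selbergPoly _ _ _ _ _
  rw [hK, tensorFun_eq_sum_eval _ _ (fun ν => (q : ℂ) ^ ν) (Finset.range (N + 1)) _
    (fun m hm i => eval_mom_inv_pow q hq0 hq1 A hA N (m i)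
      (hK ▸ le_of_mem_support_pairPoly q τ n hτ m hm i))] at hev
  simp only [Algebra.algebraMap_self, RingHom.id_apply] at hev
  rw [sum_eval_pairPoly q hq τ n hτ (fun ν => (∏ l ∈ Finset.range N, (1 - (q : ℂ) ^ l * A)) *
    (A ^ ν * ∏ l ∈ Finset.range ν,
        ((1 - (q : ℂ) ^ l * ((q : ℂ) ^ N)⁻¹) / (1 - (q : ℂ) ^ (l + 1)))))] at hev
  set P := MvPolynomial.eval (fun i : Fin n => (q : ℂ) ^ (i * τ : ℕ)) (pairPoly q τ n)
  have hle : ∀ j : Fin n, (j : ℕ) * τ ≤ N := fun j =>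
    Nat.mul_le_mul_right _ (by have := j.isLt; omega)
  have hshift : ∀ j : Fin n, (n + j - 1) * τ = j * τ + N := fun j => by
    rw [hN, ← add_mul]; congr 1; have := j.isLt; omega
  have hg : ∀ j : Fin n, ∏ l ∈ Finset.range (j * τ), (1 - (q : ℂ) ^ l * ((q : ℂ) ^ N)⁻¹) ≠ 0 := by
    refine fun j => Finset.prod_ne_zero_iff.2 fun l hl h => ?_
    rw [sub_eq_zero, eq_comm, mul_inv_eq_one₀ hqN] at h
    have h1 := hqinj h
    have h2 := Finset.mem_range.1 hl
    have h3 := hle j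
    omega
  have hm : ∀ j : Fin n, ∏ l ∈ Finset.Ico (j * τ) N, (1 - (q : ℂ) ^ l * A) ≠ 0 := by
    refine fun j => Finset.prod_ne_zero_iff.2 fun l hl h => ?_
    exact hAll 0 l (by rw [pow_zero]; exact sub_eq_zero.1 h)
  have hmaj : ∀ j : Fin n, ∏ l ∈ Finset.Ico ((n + j - 1) * τ) (2 * N),
      (1 - (q : ℂ) ^ l * A * ((q : ℂ) ^ N)⁻¹) =
        ∏ l ∈ Finset.Ico (j * τ) N, (1 - (q : ℂ) ^ l * A) := by
    intro j
    rw [hshift, two_mul, ← Finset.prod_Ico_add']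
    refine Finset.prod_congr rfl fun l _ => ?_
    rw [pow_add]; field_simp
  have hAN : ∀ j : Fin n, ∏ l ∈ Finset.range N, (1 - (q : ℂ) ^ l * A) =
      (∏ l ∈ Finset.range (j * τ), (1 - (q : ℂ) ^ l * A)) *
        ∏ l ∈ Finset.Ico (j * τ) N, (1 - (q : ℂ) ^ l * A) := fun j =>
    (Finset.prod_range_mul_prod_Ico _ (hle j)).symm
  rw [hκ, Polynomial.eval_mul, Polynomial.eval_C, Polynomial.eval_mul, eval_gapFactor,
    eval_majorFactor, hK, Finset.prod_congr rfl fun j _ => hmaj j] at hev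
  rw [hκ, Polynomial.eval_mul, Polynomial.eval_C, Polynomial.eval_mul, eval_gapFactor,
    eval_majorFactor, hK]
  set G := ∏ j : Fin n, ∏ l ∈ Finset.range (j * τ), (1 - (q : ℂ) ^ l * ((q : ℂ) ^ N)⁻¹)
  set Mj := ∏ j : Fin n, ∏ l ∈ Finset.Ico (j * τ) N, (1 - (q : ℂ) ^ l * A)
  have hG : G ≠ 0 := Finset.prod_ne_zero_iff.2 fun j _ => hg j
  have hMj : Mj ≠ 0 := Finset.prod_ne_zero_iff.2 fun j _ => hm j
  have hW : ∏ j : Fin n, ((∏ l ∈ Finset.range N, (1 - (q : ℂ) ^ l * A)) *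
      (A ^ (j * τ : ℕ) * ∏ l ∈ Finset.range (j * τ),
        ((1 - (q : ℂ) ^ l * ((q : ℂ) ^ N)⁻¹) / (1 - (q : ℂ) ^ (l + 1))))) =
      (∏ j : Fin n, (A ^ (j * τ : ℕ) * (∏ l ∈ Finset.range (j * τ), (1 - (q : ℂ) ^ l * A)) /
        ∏ l ∈ Finset.range (j * τ), (1 - (q : ℂ) ^ (l + 1)))) * (G * Mj) := by
    simp only [G, Mj]
    rw [← Finset.prod_mul_distrib, ← Finset.prod_mul_distrib]
    refine Finset.prod_congr rfl fun j _ => ?_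
    rw [hAN j, Finset.prod_div_distrib]
    ring
  rw [hW, ← mul_assoc, ← mul_assoc] at hev
  have hκ' := mul_right_cancel₀ (mul_ne_zero hG hMj) ((mul_assoc _ _ _).symm.trans
    (hev.trans (by ring : _ = (n.factorial : ℂ) * (P * ∏ j : Fin n, (A ^ (j * τ : ℕ) *
      (∏ l ∈ Finset.range (j * τ), (1 - (q : ℂ) ^ l * A)) /
        ∏ l ∈ Finset.range (j * τ), (1 - (q : ℂ) ^ (l + 1)))) * (G * Mj))))
  rw [hκ', mul_assoc, mul_assoc, ← Finset.prod_mul_distrib, ← Finset.prod_mul_distrib]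
  congr 2
  refine Finset.prod_congr rfl fun j _ => ?_
  ring

/-- Both sides are continuous in `A`, so the countably many values excluded in
`eval_selbergPoly_of_generic` are recovered by density. -/
theorem eval_selbergPoly_eq (q : ℝ) (hq0 : 0 < q) (hq1 : q < 1) (A r : ℂ) (hA : ‖A‖ < 1)
    (τ n : ℕ) (hτ : 0 < τ) :
    (selbergPoly q A τ n).eval r = n.factorial *
      (MvPolynomial.eval (fun i : Fin n => (q : ℂ) ^ (i * τ : ℕ)) (pairPoly q τ n) *
      ∏ j : Fin n, (A ^ (j * τ : ℕ) * (∏ l ∈ Finset.range (j * τ), (1 - (q : ℂ) ^ l * A)) *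
        (∏ l ∈ Finset.range (j * τ), (1 - (q : ℂ) ^ l * r)) *
        (∏ l ∈ Finset.Ico ((n + j - 1) * τ) (2 * (n - 1) * τ), (1 - (q : ℂ) ^ l * A * r)) /
        ∏ l ∈ Finset.range (j * τ), (1 - (q : ℂ) ^ (l + 1)))) := by
  set bad : Set ℂ := insert 0 (Set.range fun k : ℤ => (q : ℂ) ^ k)
  have hbad : bad.Countable := (Set.countable_range _).insert 0
  have hd := (hbad.dense_compl ℂ).open_subset_closure_inter (Metric.isOpen_ball (x := 0) (ε := 1))
  have hmem := hd (show A ∈ Metric.ball (0 : ℂ) 1 by simpa using hA)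
  refine closure_minimal (t := {A : ℂ | (selbergPoly q A τ n).eval r = n.factorial *
      (MvPolynomial.eval (fun i : Fin n => (q : ℂ) ^ (i * τ : ℕ)) (pairPoly q τ n) *
      ∏ j : Fin n, (A ^ (j * τ : ℕ) * (∏ l ∈ Finset.range (j * τ), (1 - (q : ℂ) ^ l * A)) *
        (∏ l ∈ Finset.range (j * τ), (1 - (q : ℂ) ^ l * r)) *
        (∏ l ∈ Finset.Ico ((n + j - 1) * τ) (2 * (n - 1) * τ), (1 - (q : ℂ) ^ l * A * r)) /
        ∏ l ∈ Finset.range (j * τ), (1 - (q : ℂ) ^ (l + 1))))}) ?_ ?_ hmem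
  · rintro B ⟨hB, hB'⟩
    refine eval_selbergPoly_of_generic q hq0 hq1 B r (by simpa using hB) (fun h => hB' (Or.inl h))
      (fun k h => hB' (Or.inr ⟨k, h.symm⟩)) τ n hτ
  · refine isClosed_eq ?_ ?_
    · simp only [eval_selbergPoly, tensorFun, eval_mom]
      fun_prop
    · simp only [div_eq_mul_inv]
      fun_prop

/-! ### The pair polynomial at a geometric progression, and sums over `ℤ^n` -/

/-- With `(q)_m = ∏_{l<m} (1 - q^{l+1})`, the factor for `d` is
`(1 - q^{(d+1)τ}) (q)_{(d+2)τ-1} / (q)_{dτ}`, and the product telescopes. -/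
theorem prod_range_telescope (q : ℝ) (hq0 : 0 < q) (hq1 : q < 1) (τ : ℕ) (hτ : 0 < τ) (m : ℕ) :
    ∏ d ∈ Finset.range m, ((1 - (q : ℂ) ^ ((d + 1) * τ)) *
      ∏ l ∈ Finset.Ico (d * τ) ((d + 2) * τ - 1), (1 - (q : ℂ) ^ (l + 1))) =
    (∏ l ∈ Finset.range ((m + 1) * τ - 1), (1 - (q : ℂ) ^ (l + 1))) *
      (∏ l ∈ Finset.range (m * τ), (1 - (q : ℂ) ^ (l + 1))) /
        ∏ l ∈ Finset.range (τ - 1), (1 - (q : ℂ) ^ (l + 1)) := by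
  have hne : ∀ s : Finset ℕ, ∏ l ∈ s, (1 - (q : ℂ) ^ (l + 1)) ≠ 0 := fun s =>
    Finset.prod_ne_zero_iff.2 fun l _ => one_sub_pow_succ_ne_zero hq0 hq1 l
  induction m with
  | zero => simp [div_self (hne _)]
  | succ m ih =>
    have h1 : (m + 1) * τ = (m + 1) * τ - 1 + 1 := by
      have : 0 < (m + 1) * τ := by positivity
      omega
    have h2 : ∏ l ∈ Finset.range ((m + 1) * τ), (1 - (q : ℂ) ^ (l + 1)) =
        (∏ l ∈ Finset.range ((m + 1) * τ - 1), (1 - (q : ℂ) ^ (l + 1))) *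
          (1 - (q : ℂ) ^ ((m + 1) * τ)) := by
      conv_lhs => rw [h1, Finset.prod_range_succ, ← h1]
    have h3 := Finset.prod_range_mul_prod_Ico (fun l => 1 - (q : ℂ) ^ (l + 1))
      (show m * τ ≤ (m + 2) * τ - 1 by rw [add_mul]; omega)
    have h4 := hne (Finset.range (m * τ))
    rw [Finset.prod_range_succ, ih, h2, ← h3]
    ring

theorem prod_Ioi_fin {n : ℕ} (i : Fin n) (g : ℕ → ℂ) :
    ∏ j ∈ Finset.Ioi i, g j = ∏ k ∈ Finset.range (n - 1 - i), g (i + 1 + k) := by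
  have h := Finset.prod_map (Finset.Ioi i) Fin.valEmbedding g
  rw [Fin.map_valEmbedding_Ioi] at h
  simp only [Fin.valEmbedding_apply] at h
  rw [← h, show n - 1 - (i : ℕ) = n - (i + 1) by omega, ← Finset.prod_Ico_eq_prod_range]
  rfl

/-- The value of the pair polynomial at `(1, t, …, t^{n-1})` with `t = q^τ`. -/
theorem eval_pairPoly_geom (q : ℝ) (hq0 : 0 < q) (hq1 : q < 1) (τ n : ℕ) (hτ : 0 < τ) :
    MvPolynomial.eval (fun i : Fin n => (q : ℂ) ^ (i * τ : ℕ)) (pairPoly q τ n) =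
      ∏ j : Fin n, (((q : ℂ) ^ (j * τ : ℕ)) ^ (2 * (n - 1 - j) * τ) *
        ((∏ l ∈ Finset.range ((j + 1) * τ - 1), (1 - (q : ℂ) ^ (l + 1))) *
        (∏ l ∈ Finset.range (j * τ), (1 - (q : ℂ) ^ (l + 1))) /
        ∏ l ∈ Finset.range (τ - 1), (1 - (q : ℂ) ^ (l + 1)))) := by
  have hq : (q : ℂ) ≠ 0 := by exact_mod_cast hq0.ne'
  rw [eval_pairPoly, Finset.prod_mul_distrib]
  rw [← Equiv.prod_comp Fin.revPerm fun j : Fin n =>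
    ((∏ l ∈ Finset.range ((j + 1) * τ - 1), (1 - (q : ℂ) ^ (l + 1))) *
        (∏ l ∈ Finset.range (j * τ), (1 - (q : ℂ) ^ (l + 1))) /
        ∏ l ∈ Finset.range (τ - 1), (1 - (q : ℂ) ^ (l + 1))), ← Finset.prod_mul_distrib]
  refine Finset.prod_congr rfl fun i _ => ?_
  rw [prod_Ioi_fin i fun j => ((q : ℂ) ^ (i * τ : ℕ) - (q : ℂ) ^ (j * τ)) *
    ∏ l ∈ Finset.Icc (1 - (τ : ℤ)) (τ - 1),
      ((q : ℂ) ^ (i * τ : ℕ) - (q : ℂ) ^ l * (q : ℂ) ^ (j * τ))]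
  have hrev : ((Fin.revPerm i : Fin n) : ℕ) = n - 1 - i := by
    simp [Fin.val_rev]; omega
  rw [hrev, ← prod_range_telescope q hq0 hq1 τ hτ]
  have hpow : ((q : ℂ) ^ (i * τ : ℕ)) ^ (2 * (n - 1 - i) * τ) =
      ∏ _d ∈ Finset.range (n - 1 - i), ((q : ℂ) ^ (i * τ : ℕ)) ^ (2 * τ) := by
    rw [Finset.prod_const, Finset.card_range, ← pow_mul _ (2 * τ)]
    congr 1; ring
  rw [hpow, ← Finset.prod_mul_distrib]
  refine Finset.prod_congr rfl fun d _ => ?_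
  set x := (q : ℂ) ^ (i * τ : ℕ)
  have e1 : (q : ℂ) ^ ((i + 1 + d) * τ) = x * (q : ℂ) ^ ((d + 1) * τ) := by
    rw [← pow_add]; congr 1; ring
  have e2 : ∏ l ∈ Finset.Icc (1 - (τ : ℤ)) (τ - 1),
      (x - (q : ℂ) ^ l * (x * (q : ℂ) ^ ((d + 1) * τ))) =
      x ^ (2 * τ - 1) * ∏ l ∈ Finset.Icc (1 - (τ : ℤ)) (τ - 1),
        (1 - (q : ℂ) ^ l * (q : ℂ) ^ ((d + 1) * τ)) := by
    have : x ^ (2 * τ - 1) = ∏ _l ∈ Finset.Icc (1 - (τ : ℤ)) (τ - 1), x := by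
      rw [Finset.prod_const, Int.card_Icc]; congr 1; omega
    rw [this, ← Finset.prod_mul_distrib]
    exact Finset.prod_congr rfl fun l _ => by ring
  have hdτ : (d + 1) * τ = d * τ + τ := by ring
  have hdτ2 : (d + 2) * τ = d * τ + 2 * τ := by ring
  have e3 : ∏ l ∈ Finset.Icc (1 - (τ : ℤ)) (τ - 1), (1 - (q : ℂ) ^ l * (q : ℂ) ^ ((d + 1) * τ)) =
      ∏ l ∈ Finset.Ico (d * τ) ((d + 2) * τ - 1), (1 - (q : ℂ) ^ (l + 1)) := by
    symm
    refine Finset.prod_nbij (fun l : ℕ => (l : ℤ) + 1 - ((d + 1) * τ : ℕ)) ?_ ?_ ?_ ?_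
    · intro l hl
      simp only [Finset.mem_Ico, Finset.mem_Icc] at hl ⊢
      omega
    · intro a _ b _ h
      simp only at h
      omega
    · intro l hl
      simp only [Finset.coe_Icc, Set.mem_Icc] at hl
      refine ⟨(l + ((d + 1) * τ : ℕ) - 1).toNat, ?_, ?_⟩
      · simp only [Finset.coe_Ico, Set.mem_Ico]
        omega
      · simp only
        omega
    · intro l _
      rw [zpow_sub₀ hq, zpow_natCast, div_mul_cancel₀ _ (pow_ne_zero _ hq)]
      congr 1
  rw [e1, e2, e3]
  have e4 : x ^ (2 * τ) = x ^ (2 * τ - 1) * x := by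
    rw [← pow_succ]; congr 1; omega
  rw [e4]
  ring

theorem hasSum_pi_prod : ∀ (n : ℕ) (f : Fin n → ℤ → ℂ), (∀ i, Summable (f i)) →
    HasSum (fun ν : Fin n → ℤ => ∏ i, f i (ν i)) (∏ i, ∑' k, f i k) := by
  intro n
  induction n with
  | zero => intro f _; simp
  | succ n ih =>
    intro f hf
    have h1 := ih (fun i => f i.succ) fun i => hf i.succ
    have h2 := summable_mul_of_summable_norm (hf 0).norm h1.summable.norm
    have h3 := (hf 0).hasSum.mul h1 h2
    rw [Fin.prod_univ_succ, ← (Fin.consEquiv fun _ : Fin (n + 1) => ℤ).hasSum_iff]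
    refine h3.congr_fun fun p => ?_
    simp [Fin.prod_univ_succ, Fin.consEquiv]

theorem hasSum_eval_mul_prod {n : ℕ} (p : MvPolynomial (Fin n) ℂ) (y g : ℤ → ℂ)
    (h : ∀ m ∈ p.support, ∀ i, Summable fun ν => y ν ^ m i * g ν) :
    HasSum (fun ν : Fin n → ℤ => MvPolynomial.eval (fun i => y (ν i)) p * ∏ i, g (ν i))
      (tensorFun (fun k => ∑' ν, y ν ^ k * g ν) p) := by
  have h1 : HasSum (fun ν : Fin n → ℤ =>
      ∑ m ∈ p.support, p.coeff m * ∏ i, (y (ν i) ^ m i * g (ν i)))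
      (∑ m ∈ p.support, p.coeff m * ∏ i, ∑' ν, y ν ^ m i * g ν) := by
    refine hasSum_sum fun m hm => ?_
    exact (hasSum_pi_prod n (fun i ν => y ν ^ m i * g ν) (h m hm)).mul_left (p.coeff m)
  refine h1.congr_fun fun ν => ?_
  rw [MvPolynomial.eval_eq', Finset.sum_mul]
  refine Finset.sum_congr rfl fun m _ => ?_
  rw [Finset.prod_mul_distrib, mul_assoc]

/-- For the principal power a positive real factor splits off without any branch correction. -/
theorem mul_ofReal_cpow {x : ℂ} (hx : x ≠ 0) {s : ℝ} (hs : 0 < s) (α : ℂ) :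
    (x * (s : ℂ)) ^ α = x ^ α * (s : ℂ) ^ α := by
  have hs' : (s : ℂ) ≠ 0 := by exact_mod_cast hs.ne'
  rw [Complex.cpow_def_of_ne_zero (mul_ne_zero hx hs'), Complex.cpow_def_of_ne_zero hx,
    Complex.cpow_def_of_ne_zero hs', Complex.log_mul_ofReal s hs x hx, ← Complex.exp_add,
    Complex.ofReal_log hs.le]
  ring_nf

theorem ofReal_zpow_cpow {q : ℝ} (hq0 : 0 < q) (k : ℤ) (α : ℂ) :
    ((q : ℂ) ^ k) ^ α = ((q : ℂ) ^ α) ^ k := by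
  have hq : (q : ℂ) ≠ 0 := by exact_mod_cast hq0.ne'
  rw [← Complex.cpow_int_mul, Complex.cpow_def_of_ne_zero (zpow_ne_zero k hq),
    Complex.cpow_def_of_ne_zero hq, ← Complex.ofReal_zpow, ← Complex.ofReal_log (by positivity),
    ← Complex.ofReal_log hq0.le, Real.log_zpow]
  push_cast; ring_nf

/-- The integrand is the pair polynomial times one-variable weights: the power `z_i^{2τ-1}` clears
the denominators of the `2τ - 1` factors `1 - q^l z_j / z_i`. -/
theorem Phi_mul_Delta (q : ℝ) (hq0 : 0 < q) (hq1 : q < 1) (n τ : ℕ) (hτ : 0 < τ)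
    (α a₁ b₁ : ℂ) (z : Fin n → ℂ) (hz : ∀ i, z i ≠ 0) :
    Phi q α τ a₁ b₁ z * Delta z = MvPolynomial.eval z (pairPoly q τ n) *
      ∏ i, (z i ^ α * (qPoch q ((q : ℂ) * a₁⁻¹ * z i) / qPoch q (b₁ * z i))) := by
  rw [eval_pairPoly, Phi, Delta]
  have h : ∀ i, ∀ j ∈ Finset.Ioi i,
      z i ^ (2 * (τ : ℂ) - 1) * pairQuot q ((q : ℂ) ^ (τ : ℂ)) (z j / z i) =
        ∏ l ∈ Finset.Icc (1 - (τ : ℤ)) (τ - 1), (z i - (q : ℂ) ^ l * z j) := by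
    intro i j _
    have h1 : z i ^ (2 * (τ : ℂ) - 1) = ∏ _l ∈ Finset.Icc (1 - (τ : ℤ)) (τ - 1), z i := by
      have : (2 * (τ : ℂ) - 1) = ((2 * τ - 1 : ℕ) : ℂ) := by
        rw [Nat.cast_sub (by omega)]; push_cast; ring
      rw [this, Complex.cpow_natCast, Finset.prod_const, Int.card_Icc]; congr 1; omega
    rw [pairQuot_eq_prod q hq0 hq1 τ hτ, h1, ← Finset.prod_mul_distrib]
    refine Finset.prod_congr rfl fun l _ => ?_
    have := hz i
    field_simp
  rw [Finset.prod_congr rfl fun i _ => Finset.prod_congr rfl (h i)]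
  simp only [Finset.prod_mul_distrib]
  ring

/-! ### From the Selberg polynomial to the Jackson integral -/

/-- The shift of the argument by `q^{-k}`. -/
theorem qPoch_mul_inv_pow (q : ℝ) (hq0 : 0 < q) (hq1 : q < 1) {w : ℂ} (hw : w ≠ 0) (k : ℕ) :
    qPoch q (q * w⁻¹ * ((q : ℂ) ^ k)⁻¹) * ∏ l ∈ Finset.range k, (-((q : ℂ) ^ l * w)) =
      (∏ l ∈ Finset.range k, (1 - (q : ℂ) ^ l * w)) * qPoch q (q * w⁻¹) := by
  have hq : (q : ℂ) ≠ 0 := by exact_mod_cast hq0.ne'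
  induction k with
  | zero => simp
  | succ k ih =>
    have hqk := pow_ne_zero k hq
    have h := qPoch_eq_one_sub_mul q hq0 hq1 (q * w⁻¹ * ((q : ℂ) ^ (k + 1))⁻¹)
    have e1 : (q : ℂ) * (q * w⁻¹ * ((q : ℂ) ^ (k + 1))⁻¹) = q * w⁻¹ * ((q : ℂ) ^ k)⁻¹ := by
      rw [pow_succ]; field_simp
    have e2 : (1 - q * w⁻¹ * ((q : ℂ) ^ (k + 1))⁻¹) * (-((q : ℂ) ^ k * w)) =
        1 - (q : ℂ) ^ k * w := by
      rw [pow_succ]; field_simp; ring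
    rw [e1] at h
    rw [h, Finset.prod_range_succ, Finset.prod_range_succ, ← e2]
    linear_combination (1 - q * w⁻¹ * ((q : ℂ) ^ (k + 1))⁻¹) * (-((q : ℂ) ^ k * w)) * ih

theorem prod_range_neg_pow_mul (q w : ℂ) (k : ℕ) :
    ∏ l ∈ Finset.range k, (-(q ^ l * w)) = w ^ k * ∏ l ∈ Finset.range k, (-q ^ l) := by
  simp only [show ∀ l : ℕ, -(q ^ l * w) = w * -q ^ l from fun l => by ring,
    Finset.prod_mul_distrib, Finset.prod_const, Finset.card_range]

/-- The moments of the bilateral functional, relative to the total mass. -/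
theorem psi_pow_mul (q : ℝ) (hq0 : 0 < q) (hq1 : q < 1) {a₁ b₁ x A : ℂ} (ha₁ : a₁ ≠ 0)
    (hu : ∀ k : ℤ, b₁ * x * (q : ℂ) ^ k ≠ 1) (hA : ‖A‖ < 1) {K : ℕ}
    (hv : ‖(q : ℂ) * a₁⁻¹ * x‖ < ‖(q : ℂ) ^ K * A * (b₁ * x)‖) (k : ℕ) (hk : k ≤ K) :
    x ^ k * psi q (b₁ * x) (q * a₁⁻¹ * x) ((q : ℂ) ^ k * A) *
        ∏ l ∈ Finset.range k, (1 - (q : ℂ) ^ l * A * (a₁ * b₁)) =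
      a₁ ^ k * (∏ l ∈ Finset.range k, (1 - (q : ℂ) ^ l * A)) *
        psi q (b₁ * x) (q * a₁⁻¹ * x) A := by
  have hq : (q : ℂ) ≠ 0 := by exact_mod_cast hq0.ne'
  have hqn : ‖(q : ℂ)‖ = q := norm_ofReal_base hq0
  induction k with
  | zero => simp
  | succ k ih =>
    have hAk : ‖(q : ℂ) ^ k * A‖ < 1 := (norm_pow_mul_le hq0 hq1 k A).trans_lt hA
    have hle : ‖(q : ℂ) ^ K * A * (b₁ * x)‖ ≤ ‖(q : ℂ) * ((q : ℂ) ^ k * A) * (b₁ * x)‖ := by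
      rw [← mul_assoc (q : ℂ), ← pow_succ', mul_assoc, mul_assoc, norm_mul,
        norm_mul ((q : ℂ) ^ (k + 1)), norm_pow, norm_pow, hqn]
      exact mul_le_mul_of_nonneg_right (pow_le_pow_of_le_one hq0.le hq1.le hk) (norm_nonneg _)
    have h := psi_mul_left q hq0 hq1 hu hAk (hv.trans_le hle)
    have ih' := ih (by omega)
    have e : (q : ℂ) * a₁⁻¹ * x / q - (q : ℂ) ^ k * A * (b₁ * x) =
        x * a₁⁻¹ * (1 - (q : ℂ) ^ k * A * (a₁ * b₁)) := by field_simp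
    rw [e, ← mul_assoc (q : ℂ), ← pow_succ'] at h
    rw [Finset.prod_range_succ, Finset.prod_range_succ, pow_succ x, pow_succ a₁]
    have h' : psi q (b₁ * x) (q * a₁⁻¹ * x) ((q : ℂ) ^ (k + 1) * A) * x *
        (1 - (q : ℂ) ^ k * A * (a₁ * b₁)) =
        a₁ * (psi q (b₁ * x) (q * a₁⁻¹ * x) ((q : ℂ) ^ k * A) * (1 - (q : ℂ) ^ k * A)) := by
      rw [h]; field_simp
    linear_combination x ^ k * (∏ l ∈ Finset.range k, (1 - (q : ℂ) ^ l * A * (a₁ * b₁))) * h' +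
      a₁ * (1 - (q : ℂ) ^ k * A) * ih'

/-- The sum over the lattice, by the moments of `psi_pow_mul` and homogeneity of `pairPoly`. -/
theorem hasSum_Phi_mul_Delta (q : ℝ) (hq0 : 0 < q) (hq1 : q < 1) (n τ : ℕ) (hτ : 0 < τ)
    (α a₁ b₁ x : ℂ) (ha₁ : a₁ ≠ 0) (hx : x ≠ 0)
    (hu : ∀ k : ℤ, b₁ * x * (q : ℂ) ^ k ≠ 1) (hA : ‖(q : ℂ) ^ α‖ < 1)
    (hv : ‖(q : ℂ) * a₁⁻¹ * x‖ < ‖(q : ℂ) ^ (2 * (n - 1) * τ) * (q : ℂ) ^ α * (b₁ * x)‖)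
    (hC : ∀ l < 2 * (n - 1) * τ, 1 - (q : ℂ) ^ l * (q : ℂ) ^ α * (a₁ * b₁) ≠ 0) :
    HasSum (fun ν : Fin n → ℤ =>
      Phi q α τ a₁ b₁ (latticePoint q (fun _ => x) ν) * Delta (latticePoint q (fun _ => x) ν))
      ((x ^ α * psi q (b₁ * x) (q * a₁⁻¹ * x) ((q : ℂ) ^ α) /
        ∏ l ∈ Finset.range (2 * (n - 1) * τ), (1 - (q : ℂ) ^ l * (q : ℂ) ^ α * (a₁ * b₁))) ^ n *
        a₁ ^ (τ * (n * (n - 1))) * (selbergPoly q ((q : ℂ) ^ α) τ n).eval (a₁ * b₁)) := by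
  have hq : (q : ℂ) ≠ 0 := by exact_mod_cast hq0.ne'
  have hqn : ‖(q : ℂ)‖ = q := norm_ofReal_base hq0
  set A := (q : ℂ) ^ α with hAdef
  set K := 2 * (n - 1) * τ with hK
  set u := b₁ * x with hu_def
  set v := (q : ℂ) * a₁⁻¹ * x with hv_def
  have hyg : ∀ (k : ℕ) (ν : ℤ), (x * (q : ℂ) ^ ν) ^ k * (x ^ α * psiTerm q u v A ν) =
      x ^ α * x ^ k * psiTerm q u v ((q : ℂ) ^ k * A) ν := by
    intro k ν
    have : ((q : ℂ) ^ ν) ^ k = ((q : ℂ) ^ k) ^ ν := by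
      rw [← zpow_natCast, ← zpow_mul, ← zpow_natCast, ← zpow_mul, mul_comm]
    rw [psiTerm, psiTerm, mul_pow, mul_zpow, this]; ring
  have hsum : ∀ k ≤ K, Summable (psiTerm q u v ((q : ℂ) ^ k * A)) := by
    intro k hk
    refine summable_psiTerm q hq0 hq1 hu ((norm_pow_mul_le hq0 hq1 k A).trans_lt hA)
      (hv.trans_le ?_)
    rw [mul_assoc, mul_assoc, norm_mul, norm_mul ((q : ℂ) ^ k), norm_pow, norm_pow, hqn]
    exact mul_le_mul_of_nonneg_right (pow_le_pow_of_le_one hq0.le hq1.le hk) (norm_nonneg _)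
  have h1 := hasSum_eval_mul_prod (pairPoly q τ n) (fun ν => x * (q : ℂ) ^ ν)
    (fun ν => x ^ α * psiTerm q u v A ν) (fun m hm i => by
      simp only [hyg]
      exact (hsum _ (le_of_mem_support_pairPoly q τ n hτ m hm i)).mul_left _)
  have h2 : tensorFun (fun k => ∑' ν : ℤ, (x * (q : ℂ) ^ ν) ^ k * (x ^ α * psiTerm q u v A ν))
      (pairPoly q τ n) = (x ^ α * psi q u v A /
        ∏ l ∈ Finset.range K, (1 - (q : ℂ) ^ l * A * (a₁ * b₁))) ^ n *
        a₁ ^ (τ * (n * (n - 1))) * (selbergPoly q A τ n).eval (a₁ * b₁) := by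
    rw [eval_selbergPoly]
    refine tensorFun_scale _ _ _ _ _ (fun m hm => sum_of_mem_support_pairPoly q τ n hτ m hm)
      fun m hm i => ?_
    have hk := le_of_mem_support_pairPoly q τ n hτ m hm i
    generalize m i = k at hk
    simp only [hyg]
    rw [tsum_mul_left, eval_mom]
    have h3 := psi_pow_mul q hq0 hq1 ha₁ hu hA hv k hk
    change _ = _ * psi q u v A at h3
    rw [← hu_def, ← hv_def] at h3
    have h4 := Finset.prod_range_mul_prod_Ico (fun l => 1 - (q : ℂ) ^ l * A * (a₁ * b₁)) hk
    have h5 : ∏ l ∈ Finset.range K, (1 - (q : ℂ) ^ l * A * (a₁ * b₁)) ≠ 0 :=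
      Finset.prod_ne_zero_iff.2 fun l hl => hC l (Finset.mem_range.1 hl)
    rw [← h4] at h5 ⊢
    have h6 := left_ne_zero_of_mul h5
    have h7 := right_ne_zero_of_mul h5
    change _ * psi q u v _ = _
    generalize (∏ l ∈ Finset.range k, (1 - (q : ℂ) ^ l * A * (a₁ * b₁))) = s1 at *
    generalize (∏ l ∈ Finset.Ico k K, (1 - (q : ℂ) ^ l * A * (a₁ * b₁))) = s2 at *
    generalize (∏ l ∈ Finset.range k, (1 - (q : ℂ) ^ l * A)) = s3 at *
    field_simp
    linear_combination x ^ α * h3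
  rw [h2] at h1
  refine h1.congr_fun fun ν => ?_
  rw [Phi_mul_Delta q hq0 hq1 n τ hτ α a₁ b₁ (latticePoint q (fun _ => x) ν)
    fun i => mul_ne_zero hx (zpow_ne_zero _ hq)]
  congr 1
  refine Finset.prod_congr rfl fun i _ => ?_
  have hpow : (x * (q : ℂ) ^ ν i) ^ α = x ^ α * A ^ ν i := by
    rw [← Complex.ofReal_zpow, mul_ofReal_cpow hx (by positivity), Complex.ofReal_zpow,
      ofReal_zpow_cpow hq0]
  simp only [latticePoint, hpow, psiTerm]
  rw [mul_assoc (x ^ α), ← mul_assoc b₁, ← mul_assoc ((q : ℂ) * a₁⁻¹)]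

/-- The rational identity behind `selberg_factor_eq`, with every infinite product and every finite
`q`-product replaced by a free variable. -/
theorem factor_identity {A a b x qq e0 e1 ek Ak rk CM J pr pA pC Sk SM ΘA Θu xα Qk psi' : ℂ}
    {k N m : ℕ} (hA : A ≠ 0) (ha : a ≠ 0) (hb : b ≠ 0) (hx : x ≠ 0) (hqq : qq ≠ 0)
    (he0 : e0 ≠ 0) (he1 : e1 ≠ 0) (hek : ek ≠ 0) (hAk : Ak ≠ 0) (hCM : CM ≠ 0) (hJ : J ≠ 0)
    (hpA : pA ≠ 0) (hpC : pC ≠ 0) (hSk : Sk ≠ 0) (hSM : SM ≠ 0) (hΘu : Θu ≠ 0)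
    (hpsi : psi' = qq * pr * ΘA / (pC * pA * Θu)) :
    qq * (qq / e0) * (rk * pr / ((a * b) ^ k * Sk)) /
        ((qq / e1) * (pA / Ak) * (CM * pC / ((A * (a * b)) ^ (k + N) * SM))) *
      (xα * A ^ k * (x * Qk) ^ m *
        ((ΘA / ((A * (b * x)) ^ (k + N) * SM)) / (Θu / ((b * x) ^ k * Sk)))) * x ^ N =
    (xα * psi' / (CM * J)) * a ^ N * (Qk ^ m * (e1 * ek / e0) * (A ^ k * Ak * rk * J / ek)) *
      x ^ m := by
  subst hpsi
  simp only [mul_pow, pow_add]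
  field_simp

theorem prod_Icc_one_eq (n : ℕ) (f : ℕ → ℂ) :
    ∏ i ∈ Finset.Icc 1 n, f i = ∏ j : Fin n, f (j + 1) := by
  rw [Fin.prod_univ_eq_prod_range (fun j => f (j + 1)) n, Finset.range_eq_Ico,
    Finset.prod_Ico_add' f 0 n 1]
  rfl

/-- The `j`-th factors on the two sides agree, except for powers of `x` whose products over all `j`
are equal. -/
theorem selberg_factor_eq (q : ℝ) (hq0 : 0 < q) (hq1 : q < 1) (n τ : ℕ) (hτ : 0 < τ) (t : ℂ)
    (ht : t = (q : ℂ) ^ τ) (α a₁ b₁ x : ℂ) (ha₁ : a₁ ≠ 0) (hb₁ : b₁ ≠ 0) (hx : x ≠ 0)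
    (hu : ∀ k : ℤ, b₁ * x * (q : ℂ) ^ k ≠ 1) (hA : ‖(q : ℂ) ^ α‖ < 1)
    (hr : ‖(q : ℂ) * a₁⁻¹ * b₁⁻¹‖ < ‖(q : ℂ) ^ (2 * (n - 1) * τ) * (q : ℂ) ^ α‖)
    (hv : ‖(q : ℂ) * a₁⁻¹ * x‖ < ‖(q : ℂ) ^ (2 * (n - 1) * τ) * (q : ℂ) ^ α * (b₁ * x)‖)
    (hC : ∀ l < 2 * (n - 1) * τ, 1 - (q : ℂ) ^ l * (q : ℂ) ^ α * (a₁ * b₁) ≠ 0) (j : Fin n) :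
    x ^ α * psi q (b₁ * x) (q * a₁⁻¹ * x) ((q : ℂ) ^ α) /
        (∏ l ∈ Finset.range (2 * (n - 1) * τ), (1 - (q : ℂ) ^ l * (q : ℂ) ^ α * (a₁ * b₁))) *
      a₁ ^ ((n - 1) * τ) * (((q : ℂ) ^ (j * τ : ℕ)) ^ (2 * (n - 1 - j) * τ) *
        ((∏ l ∈ Finset.range ((j + 1) * τ - 1), (1 - (q : ℂ) ^ (l + 1))) *
        (∏ l ∈ Finset.range (j * τ), (1 - (q : ℂ) ^ (l + 1))) /
        ∏ l ∈ Finset.range (τ - 1), (1 - (q : ℂ) ^ (l + 1))) *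
      (((q : ℂ) ^ α) ^ (j * τ : ℕ) *
        (∏ l ∈ Finset.range (j * τ), (1 - (q : ℂ) ^ l * (q : ℂ) ^ α)) *
        (∏ l ∈ Finset.range (j * τ), (1 - (q : ℂ) ^ l * (a₁ * b₁))) *
        (∏ l ∈ Finset.Ico ((n + j - 1) * τ) (2 * (n - 1) * τ),
          (1 - (q : ℂ) ^ l * (q : ℂ) ^ α * (a₁ * b₁))) /
        ∏ l ∈ Finset.range (j * τ), (1 - (q : ℂ) ^ (l + 1)))) * x ^ (2 * (n - 1 - j) * τ) =
    qPoch q q * qPoch q t * qPoch q ((q : ℂ) * a₁⁻¹ * b₁⁻¹ * (t ^ (j + 1 - 1 : ℕ))⁻¹) /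
        (qPoch q (t ^ (j + 1 : ℕ)) * qPoch q ((q : ℂ) ^ α * t ^ (j + 1 - 1 : ℕ)) *
          qPoch q ((q : ℂ) ^ (1 - α) * a₁⁻¹ * b₁⁻¹ * (t ^ (n + (j + 1) - 2 : ℕ))⁻¹)) *
      ((x * t ^ (j + 1 - 1 : ℕ)) ^ (α + 2 * ((n : ℂ) - ((j + 1 : ℕ) : ℂ)) * (τ : ℂ)) *
        (qTheta q ((q : ℂ) ^ α * b₁ * t ^ (n + (j + 1) - 2 : ℕ) * x) /
          qTheta q (b₁ * t ^ (j + 1 - 1 : ℕ) * x))) * x ^ ((n - 1) * τ) := by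
  have hq : (q : ℂ) ≠ 0 := by exact_mod_cast hq0.ne'
  set A := (q : ℂ) ^ α with hAdef
  have hA0 : A ≠ 0 := by simp [hAdef, Complex.cpow_eq_zero_iff, hq]
  have hu0 : b₁ * x ≠ 0 := mul_ne_zero hb₁ hx
  have hr0 : a₁ * b₁ ≠ 0 := mul_ne_zero ha₁ hb₁
  set N := (n - 1) * τ with hN
  set K := 2 * (n - 1) * τ with hK
  set S := ∏ l ∈ Finset.range K, (1 - (q : ℂ) ^ l * A * (a₁ * b₁)) with hSdef
  have hj := j.isLt
  have hM : n + (j + 1) - 2 = n + j - 1 := by omega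
  have hMk : (n + j - 1) * τ = j * τ + N := by
    rw [hN, ← add_mul]; congr 1; omega
  have htp : ∀ i : ℕ, t ^ i = (q : ℂ) ^ (i * τ) := fun i => by rw [ht, ← pow_mul, mul_comm]
  have hne : ∀ s : Finset ℕ, ∏ l ∈ s, (1 - (q : ℂ) ^ (l + 1)) ≠ 0 := fun s =>
    Finset.prod_ne_zero_iff.2 fun l _ => one_sub_pow_succ_ne_zero hq0 hq1 l
  have hqq : qPoch q q ≠ 0 := qPoch_ne_zero q hq0 hq1 _ fun i =>
    pow_mul_ne_one hq0 hq1 i (by rwa [norm_ofReal_base hq0])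
  have hpA : qPoch q A ≠ 0 := qPoch_ne_zero q hq0 hq1 _ fun i =>
    pow_mul_ne_one hq0 hq1 i hA
  have hpC : qPoch q (q * (A * (a₁ * b₁))⁻¹) ≠ 0 := by
    refine qPoch_ne_zero q hq0 hq1 _ fun i => pow_mul_ne_one hq0 hq1 i ?_
    have h1 : ‖(q : ℂ) * a₁⁻¹ * b₁⁻¹‖ < ‖A‖ := hr.trans_le (norm_pow_mul_le hq0 hq1 K A)
    rw [show (q : ℂ) * (A * (a₁ * b₁))⁻¹ = q * a₁⁻¹ * b₁⁻¹ / A by field_simp, norm_div,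
      div_lt_one (norm_pos_iff.2 hA0)]
    exact h1
  have hneg : ∀ k : ℕ, ∏ l ∈ Finset.range k, (-(q : ℂ) ^ l) ≠ 0 := fun k =>
    Finset.prod_ne_zero_iff.2 fun l _ => neg_ne_zero.2 (pow_ne_zero l hq)
  have hΘu : qTheta q (b₁ * x) ≠ 0 := qTheta_ne_zero q hq0 hq1 _ hu0 hu
  have hAu : A * (b₁ * x) ≠ 0 := mul_ne_zero hA0 hu0
  have hC0 : A * (a₁ * b₁) ≠ 0 := mul_ne_zero hA0 hr0
  have hsplit := Finset.prod_range_mul_prod_Ico (fun l => 1 - (q : ℂ) ^ l * A * (a₁ * b₁))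
    (show (n + j - 1) * τ ≤ K from Nat.mul_le_mul_right _ (by omega))
  have hS0 : S ≠ 0 := Finset.prod_ne_zero_iff.2 fun l hl => hC l (Finset.mem_range.1 hl)
  have hCM := left_ne_zero_of_mul (hsplit.trans_ne hS0)
  have hJ := right_ne_zero_of_mul (hsplit.trans_ne hS0)
  have hpsi := psi_eq q hq0 hq1 hu hA (hv.trans_le (by
    rw [mul_assoc]; exact norm_pow_mul_le hq0 hq1 K _))
  rw [show (q : ℂ) * a₁⁻¹ * x / (A * (b₁ * x)) = q * (A * (a₁ * b₁))⁻¹ by field_simp,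
    show (q : ℂ) * a₁⁻¹ * x / (b₁ * x) = q * (a₁ * b₁)⁻¹ by field_simp] at hpsi
  have hAk : ∏ l ∈ Finset.range (j * τ), (1 - (q : ℂ) ^ l * A) ≠ 0 :=
    Finset.prod_ne_zero_iff.2 fun l _ h => pow_mul_ne_one hq0 hq1 l hA (sub_eq_zero.1 h).symm
  have hqe : ∀ m : ℕ, qPoch q ((q : ℂ) ^ (m + 1)) =
      qPoch q q / ∏ l ∈ Finset.range m, (1 - (q : ℂ) ^ (l + 1)) := fun m => by
    have h1 := qPoch_eq_prod_mul q hq0 hq1 q m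
    simp only [← pow_succ] at h1
    rw [eq_div_iff (hne _), h1, mul_comm]
  have hT0 := hqe (τ - 1)
  rw [Nat.sub_add_cancel hτ, ← ht] at hT0
  have hT1 := hqe ((j + 1) * τ - 1)
  rw [Nat.sub_add_cancel (Nat.mul_pos (Nat.succ_pos j) hτ), ← htp] at hT1
  have hQA : qPoch q (A * t ^ (j : ℕ)) =
      qPoch q A / ∏ l ∈ Finset.range (j * τ), (1 - (q : ℂ) ^ l * A) := by
    rw [eq_div_iff hAk, htp, qPoch_eq_prod_mul q hq0 hq1 A (j * τ)]; ring_nf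
  have hf : ∀ (w : ℂ) (hw : w ≠ 0) (k : ℕ), qPoch q (q * w⁻¹ * ((q : ℂ) ^ k)⁻¹) =
      (∏ l ∈ Finset.range k, (1 - (q : ℂ) ^ l * w)) * qPoch q (q * w⁻¹) /
        (w ^ k * ∏ l ∈ Finset.range k, (-(q : ℂ) ^ l)) := fun w hw k => by
    rw [eq_div_iff (mul_ne_zero (pow_ne_zero _ hw) (hneg k)),
      ← prod_range_neg_pow_mul, qPoch_mul_inv_pow q hq0 hq1 hw]
  have hf1 := hf _ hr0 (j * τ)
  have hf2 := hf _ hC0 ((n + j - 1) * τ)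
  rw [Finset.prod_congr rfl fun l _ => by rw [← mul_assoc ((q : ℂ) ^ l)]] at hf2
  have hθ : ∀ (w : ℂ) (hw : w ≠ 0) (k : ℕ), qTheta q ((q : ℂ) ^ k * w) =
      qTheta q w / (w ^ k * ∏ l ∈ Finset.range k, (-(q : ℂ) ^ l)) := fun w hw k => by
    rw [eq_div_iff (mul_ne_zero (pow_ne_zero _ hw) (hneg k)),
      ← prod_range_neg_pow_mul, qTheta_pow_mul q hq0 hq1 hw]
  have hθ1 := hθ _ hu0 (j * τ)
  have hθ2 := hθ _ hAu ((n + j - 1) * τ)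
  -- principal powers split here because `t^j` is a positive real number
  have hcpow : (x * t ^ (j : ℕ)) ^ (α + 2 * ((n : ℂ) - ((j + 1 : ℕ) : ℂ)) * (τ : ℂ)) =
      x ^ α * A ^ (j * τ : ℕ) * (x * (q : ℂ) ^ (j * τ : ℕ)) ^ (2 * (n - 1 - j) * τ) := by
    have h1 : 2 * ((n : ℂ) - ((j + 1 : ℕ) : ℂ)) * (τ : ℂ) = ((2 * (n - 1 - j) * τ : ℕ) : ℂ) := by
      obtain ⟨d, hd⟩ : ∃ d, n = j + 1 + d := ⟨n - (j + 1), by omega⟩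
      rw [show n - 1 - (j : ℕ) = d by omega]
      nth_rw 1 [hd]
      push_cast; ring
    rw [htp, h1, Complex.cpow_add _ _ (mul_ne_zero hx (pow_ne_zero _ hq)), Complex.cpow_natCast]
    congr 1
    rw [← Complex.ofReal_pow, mul_ofReal_cpow hx (by positivity), Complex.ofReal_pow]
    have := ofReal_zpow_cpow hq0 (j * τ : ℕ) α
    rw [zpow_natCast, zpow_natCast] at this
    rw [this]
  -- every argument is a shift by a power of `q`, of an argument occurring in `psi_eq`
  have g1 : (q : ℂ) * a₁⁻¹ * b₁⁻¹ * (t ^ (j : ℕ))⁻¹ =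
      q * (a₁ * b₁)⁻¹ * ((q : ℂ) ^ (j * τ : ℕ))⁻¹ := by
    rw [htp, mul_inv]; ring
  have g2 : (q : ℂ) ^ (1 - α) * a₁⁻¹ * b₁⁻¹ * (t ^ (n + j - 1))⁻¹ =
      q * (A * (a₁ * b₁))⁻¹ * ((q : ℂ) ^ ((n + j - 1) * τ))⁻¹ := by
    rw [htp, Complex.cpow_sub _ _ hq, Complex.cpow_one, ← hAdef, mul_inv, mul_inv]; ring
  have g3 : A * b₁ * t ^ (n + j - 1) * x = (q : ℂ) ^ ((n + j - 1) * τ) * (A * (b₁ * x)) := by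
    rw [htp]; ring
  have g4 : b₁ * t ^ (j : ℕ) * x = (q : ℂ) ^ (j * τ : ℕ) * (b₁ * x) := by
    rw [htp]; ring
  rw [hM, Nat.add_sub_cancel, hcpow, g1, g2, g3, g4, hf1, hf2, hθ1, hθ2, hT0, hT1, hQA, hSdef,
    ← hsplit]
  symm
  simp only [hMk] at hCM hJ ⊢
  refine factor_identity hA0 ha₁ hb₁ hx hqq (hne _) (hne _) (hne _) hAk hCM hJ
    hpA hpC (hneg _) (hneg _) hΘu ?_
  rw [eq_div_iff (mul_ne_zero (mul_ne_zero hpC hpA) hΘu), hpsi]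

end QSelberg

theorem mainTheorem7 (q : ℝ) (hq0 : 0 < q) (hq1 : q < 1) (n : ℕ)
    (τ : ℕ) (hτ : 0 < τ) (t : ℂ) (ht : t = (q : ℂ) ^ τ)
    (α a₁ b₁ : ℂ) (ha₁ : a₁ ≠ 0) (hb₁ : b₁ ≠ 0)
    (hconv : ∀ i ∈ Finset.Icc 1 n,
      ‖(q : ℂ) * a₁⁻¹ * b₁⁻¹‖ < ‖(q : ℂ) ^ α * t ^ (2 * i - 2)‖ ∧
        ‖(q : ℂ) ^ α * t ^ (2 * i - 2)‖ < 1)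
    (x : ℂ) (hx : x ≠ 0) (hpole : ∀ k : ℤ, b₁ * (x * (q : ℂ) ^ k) ≠ 1)
    (c₁ : ℂ)
    (hc₁ : c₁ = (1 - (q : ℂ)) ^ n * ∏ j ∈ Finset.Icc 1 n,
      (QSelberg.qPoch q q * QSelberg.qPoch q t *
          QSelberg.qPoch q ((q : ℂ) * a₁⁻¹ * b₁⁻¹ * (t ^ (j - 1))⁻¹)) /
        (QSelberg.qPoch q (t ^ j) * QSelberg.qPoch q ((q : ℂ) ^ α * t ^ (j - 1)) *
          QSelberg.qPoch q
            ((q : ℂ) ^ (1 - α) * a₁⁻¹ * b₁⁻¹ * (t ^ (n + j - 2))⁻¹))) :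
    Summable (fun ν : Fin n → ℤ =>
      QSelberg.Phi q α τ a₁ b₁ (QSelberg.latticePoint q (fun _ => x) ν) *
        QSelberg.Delta (QSelberg.latticePoint q (fun _ => x) ν)) ∧
    QSelberg.IA q α τ a₁ b₁ (fun _ : Fin n => x) / (n.factorial : ℂ) =
      c₁ * ∏ i ∈ Finset.Icc 1 n,
        (x * t ^ (i - 1)) ^ (α + 2 * ((n : ℂ) - (i : ℂ)) * (τ : ℂ)) *
          (QSelberg.qTheta q ((q : ℂ) ^ α * b₁ * t ^ (n + i - 2) * x) /
            QSelberg.qTheta q (b₁ * t ^ (i - 1) * x)) := by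
  have hq : (q : ℂ) ≠ 0 := by exact_mod_cast hq0.ne'
  have hqn : ‖(q : ℂ)‖ = q := QSelberg.norm_ofReal_base hq0
  rcases Nat.eq_zero_or_pos n with rfl | hn
  · -- the lattice is a single point and all products are empty
    refine ⟨(hasSum_unique _).summable, ?_⟩
    simp [hc₁, QSelberg.IA, QSelberg.jacksonIntegral, QSelberg.Phi, QSelberg.Delta]
  set A := (q : ℂ) ^ α with hAdef
  have hA0 : A ≠ 0 := by simp [hAdef, Complex.cpow_eq_zero_iff, hq]
  have hA : ‖A‖ < 1 := by
    have := (hconv 1 (Finset.mem_Icc.2 ⟨le_rfl, hn⟩)).2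
    simpa using this
  have hu0 : b₁ * x ≠ 0 := mul_ne_zero hb₁ hx
  have hu : ∀ k : ℤ, b₁ * x * (q : ℂ) ^ k ≠ 1 := fun k => by rw [mul_assoc]; exact hpole k
  have hr : ‖(q : ℂ) * a₁⁻¹ * b₁⁻¹‖ < ‖(q : ℂ) ^ (2 * (n - 1) * τ) * A‖ := by
    have h1 := (hconv n (Finset.mem_Icc.2 ⟨hn, le_rfl⟩)).1
    rw [ht, ← pow_mul, mul_comm A] at h1
    rwa [show 2 * (n - 1) * τ = τ * (2 * n - 2) by
      rw [mul_comm τ]; congr 1; omega]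
  have hv : ‖(q : ℂ) * a₁⁻¹ * x‖ < ‖(q : ℂ) ^ (2 * (n - 1) * τ) * A * (b₁ * x)‖ := by
    have h1 := mul_lt_mul_of_pos_right hr (norm_pos_iff.2 hu0)
    rw [← norm_mul, ← norm_mul] at h1
    rwa [show (q : ℂ) * a₁⁻¹ * b₁⁻¹ * (b₁ * x) = q * a₁⁻¹ * x by field_simp] at h1
  have hr0 : a₁ * b₁ ≠ 0 := mul_ne_zero ha₁ hb₁
  -- `q < |q^K A a₁ b₁|` with `K = 2 (n - 1) τ`, so `|q^l A a₁ b₁| > 1` for `l < K`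
  have hC : ∀ l < 2 * (n - 1) * τ, 1 - (q : ℂ) ^ l * A * (a₁ * b₁) ≠ 0 := by
    intro l hl h
    have h1 : ‖(q : ℂ) ^ l * A * (a₁ * b₁)‖ = 1 := by rw [← sub_eq_zero.1 h, norm_one]
    have h2 := mul_lt_mul_of_pos_right hr (norm_pos_iff.2 hr0)
    rw [← norm_mul, ← norm_mul, show (q : ℂ) * a₁⁻¹ * b₁⁻¹ * (a₁ * b₁) = q by field_simp,
      mul_assoc, norm_mul, norm_pow, hqn] at h2
    rw [mul_assoc, norm_mul, norm_pow, hqn] at h1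
    have h3 : q ^ (2 * (n - 1) * τ) ≤ q ^ (l + 1) := pow_le_pow_of_le_one hq0.le hq1.le hl
    have h4 := mul_le_mul_of_nonneg_right h3 (norm_nonneg (A * (a₁ * b₁)))
    rw [pow_succ', mul_assoc q, h1] at h4
    linarith
  have hS := QSelberg.hasSum_Phi_mul_Delta q hq0 hq1 n τ hτ α a₁ b₁ x ha₁ hx hu hA hv hC
  refine ⟨hS.summable, ?_⟩
  rw [QSelberg.IA, QSelberg.jacksonIntegral, hS.tsum_eq, ← hAdef,
    QSelberg.eval_selbergPoly_eq q hq0 hq1 A (a₁ * b₁) hA τ n hτ,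
    QSelberg.eval_pairPoly_geom q hq0 hq1 τ n hτ, hc₁, QSelberg.prod_Icc_one_eq,
    QSelberg.prod_Icc_one_eq, mul_div_assoc, mul_assoc ((1 - (q : ℂ)) ^ n),
    ← Finset.prod_mul_distrib]
  refine congrArg ((1 - (q : ℂ)) ^ n * ·) ?_
  have hfac : (n.factorial : ℂ) ≠ 0 := by exact_mod_cast n.factorial_ne_zero
  set N := (n - 1) * τ with hN
  set K := 2 * (n - 1) * τ with hK
  set S := ∏ l ∈ Finset.range K, (1 - (q : ℂ) ^ l * A * (a₁ * b₁)) with hSdef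
  set c := x ^ α * QSelberg.psi q (b₁ * x) (q * a₁⁻¹ * x) A / S with hc
  -- the factors `x ^ (2 (n - 1 - j) τ)` have the same product as the constant ones
  have hxprod : ∏ j : Fin n, x ^ (2 * (n - 1 - j) * τ) = ∏ _j : Fin n, x ^ N := by
    have h1 : ∑ j : Fin n, 2 * (n - 1 - (j : ℕ)) * τ = ∑ _j : Fin n, N := by
      rw [Fin.sum_univ_eq_sum_range (fun j => 2 * (n - 1 - j) * τ) n, ← Finset.sum_mul,
        ← Finset.mul_sum, Finset.sum_range_reflect (fun j => j) n, mul_comm 2,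
        Finset.sum_range_id_mul_two]
      simp [hN, mul_assoc]
    rw [Finset.prod_pow_eq_pow_sum, Finset.prod_pow_eq_pow_sum, h1]
  have hN0 : ∏ _j : Fin n, x ^ N ≠ 0 := Finset.prod_ne_zero_iff.2 fun _ _ => pow_ne_zero _ hx
  have hconst : c ^ n * a₁ ^ (τ * (n * (n - 1))) = ∏ _j : Fin n, (c * a₁ ^ N) := by
    rw [Finset.prod_const, Finset.card_univ, Fintype.card_fin, mul_pow, ← pow_mul, hN]
    congr 2; ring
  rw [hconst, div_eq_iff hfac, mul_comm (n.factorial : ℂ), ← mul_assoc, ← Finset.prod_mul_distrib,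
    ← Finset.prod_mul_distrib]
  refine congrArg (· * (n.factorial : ℂ)) (mul_right_cancel₀ hN0 ?_)
  nth_rw 1 [← hxprod]
  rw [← Finset.prod_mul_distrib, ← Finset.prod_mul_distrib]
  refine Finset.prod_congr rfl fun j _ => ?_
  exact QSelberg.selberg_factor_eq q hq0 hq1 n τ hτ t ht α a₁ b₁ x ha₁ hb₁ hx hu hA hr hv hC j
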